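/- Let $d\ge 2$, let $v:2^{[d]}\to\mathbb{R}$ be a value function and let $\phi^*\in\mathbb{R}^d$ be its Shapley values, $\phi^*_j=\sum_{S\subseteq[d]\setminus\{j\}}\frac{|S|!\,(d-|S|-1)!}{d!}\,(v(S\cup\{j\})-v(S))$. Index rows by the $2^d-2$ sets $S\subset[d]$ with $S\ne\emptyset,[d]$. Let $k(S)=\frac{d-1}{\binom{d}{|S|}|S|(d-|S|)}$, let $Z'$ be the matrix with entries $Z'_{S,j}=\sqrt{k(S)}\,\mathbf 1[j\in S]$, and let $b_S=\sqrt{k(S)}\,(v(S)-v(\emptyset))$. Let $Q$ be any $d\times(d-1)$ matrix with $Q^{\mathsf T}Q=I$ and $Q^{\mathsf T}\mathbf 1=0$. Fix $\lambda\in\mathbb{R}$ and put $$U=\sqrt{\tfrac{d}{d-1}}\,Z'Q,\qquad \alpha=\frac{v([d])-v(\emptyset)}{d},\qquad b_\lambda=\sqrt{\tfrac{d}{d-1}}\,(b-\lambda Z'\mathbf 1),\qquad P_U=I-UU^{\mathsf T}.$$ Let $(p_S)$ be a probability distribution on the rows with $p_S>0$ for all $S$, and, with $u_S$ the $S$-th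 row of $U$ and $\|\cdot\|$ the Euclidean norm, put $$\eta=\max_S\frac{\|u_S\|^2}{p_S},\qquad \gamma(z)=\sum_S\frac{\|u_S\|^2}{p_S}\,z_S^2 .$$ For a random sketching matrix $\mathbf S$ with columns indexed by these sets, define the estimators $$\phi^{R}_\lambda=Q\,\operatorname*{argmin}_{x\in\mathbb{R}^{d-1}}\|\mathbf S(Ux-b_\lambda)\|^2+\alpha\mathbf 1,\qquad \phi^{M}_\lambda=Q\,U^{\mathsf T}\mathbf S^{\mathsf T}\mathbf S\,b_\lambda+\alpha\mathbf 1 .$$ If the minimizer is not unique, statements about $\phi^R_\lambda$ are understood to hold for every choice of minimizer. The matrix $\mathbf S$ is generated in one of two ways. (a) With replacement: $\mathbf S$ has $m\in\mathbb{N}$ independent rows; each has a single nonzero entry, whose position $S$ is drawn from $(p_S)$ and whose value is $1/\sqrt{m\,p_S}$. (b) Without replacement: for some $c>0$, let $q_S=\min\{1,c\,p_S\}$ and flip independent coins with heads probabilities $q_S$; for each $S$ whose coin shows heads, $\mathbf S$ has one row, whose only nonzero entry is $1/\sqrt{q_S}$ in position $S$. In this case $m:=\sum_S q_S\in\mathbb{R}$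 is the expected number of rows. There is an absolute constant $C>0$ such that, for all such data, for both sampling schemes and for all $\varepsilon>0$ and $\delta\in(0,1)$: $$m\ \ge\ C\left(\frac{\gamma(P_Ub_\lambda)}{\delta\varepsilon^2}+\eta\log\frac d\delta\right)\ \Longrightarrow\ \mathbb{P}\big[\|\phi^*-\phi^{R}_\lambda\|<\varepsilon\big]>1-\delta,$$ $$m\ \ge\ C\,\frac{\gamma(b_\lambda)}{\delta\varepsilon^2}\ \Longrightarrow\ \mathbb{P}\big[\|\phi^*-\phi^{M}_\lambda\|<\varepsilon\big]>1-\delta .$$ -/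

import Mathlib

open MeasureTheory ProbabilityTheory Matrix

noncomputable section

/-- A proper nonempty subset of `{1, …, d}`: the index set of the rows (there are `2 ^ d - 2`). -/
abbrev Coalition (d : ℕ) : Type := {S : Finset (Fin d) // S ≠ ∅ ∧ S ≠ Finset.univ}

instance instMeasurableSpaceCoalition (d : ℕ) : MeasurableSpace (Coalition d) := ⊤

/-- Euclidean norm of a real vector. -/
def euclNorm {ι : Type*} [Fintype ι] (x : ι → ℝ) : ℝ := ‖WithLp.toLp 2 x‖

/-- The Shapley values `φ*` of the value function `v`. -/
def shapley {d : ℕ} (v : Finset (Fin d) → ℝ) (j : Fin d) : ℝ :=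
  ∑ S ∈ (Finset.univ.erase j).powerset,
    ((S.card.factorial : ℝ) * ((d - S.card - 1).factorial : ℝ) / (d.factorial : ℝ)) *
      (v (insert j S) - v S)

/-- The kernel weight `k(S) = (d - 1) / (binom(d, |S|) |S| (d - |S|))`. -/
def kernelWeight {d : ℕ} (S : Coalition d) : ℝ :=
  ((d : ℝ) - 1) / ((d.choose S.1.card : ℝ) * (S.1.card : ℝ) * ((d : ℝ) - (S.1.card : ℝ)))

/-- The binary matrix `Z` of membership indicators. -/
def matZ (d : ℕ) : Matrix (Coalition d) (Fin d) ℝ :=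
  Matrix.of fun S j => if j ∈ S.1 then 1 else 0

/-- The diagonal matrix `√W`, where `W` is diagonal with entries `k(S)`. -/
def sqrtW (d : ℕ) : Matrix (Coalition d) (Coalition d) ℝ :=
  Matrix.diagonal fun S => Real.sqrt (kernelWeight S)

/-- `Z' = √W Z`. -/
def matZ' (d : ℕ) : Matrix (Coalition d) (Fin d) ℝ := sqrtW d * matZ d

/-- `b = √W v`, where the vector `v` has entries `v(S) - v(∅)`. -/
def vecB {d : ℕ} (v : Finset (Fin d) → ℝ) : Coalition d → ℝ :=
  sqrtW d *ᵥ fun S => v S.1 - v ∅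

/-- The columns of `Q` form an orthonormal basis of the orthogonal complement of the all-ones
vector of `ℝ^d`. -/
def IsOnesComplBasis {d : ℕ} (Q : Matrix (Fin d) (Fin (d - 1)) ℝ) : Prop :=
  Qᵀ * Q = 1 ∧ Qᵀ *ᵥ (fun _ => (1 : ℝ)) = 0

/-- `U = √(d / (d - 1)) Z' Q`. -/
def matU {d : ℕ} (Q : Matrix (Fin d) (Fin (d - 1)) ℝ) : Matrix (Coalition d) (Fin (d - 1)) ℝ :=
  Real.sqrt ((d : ℝ) / ((d : ℝ) - 1)) • (matZ' d * Q)

/-- `α = (v([d]) - v(∅)) / d`. -/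
def meanValue {d : ℕ} (v : Finset (Fin d) → ℝ) : ℝ := (v Finset.univ - v ∅) / (d : ℝ)

/-- `b_λ = √(d / (d - 1)) (b - λ Z' 1)`. -/
def vecBLam {d : ℕ} (v : Finset (Fin d) → ℝ) (lam : ℝ) : Coalition d → ℝ :=
  Real.sqrt ((d : ℝ) / ((d : ℝ) - 1)) • (vecB v - lam • (matZ' d *ᵥ fun _ => (1 : ℝ)))

/-- `P_U = I - U Uᵀ`. -/
def projCompl {d : ℕ} (Q : Matrix (Fin d) (Fin (d - 1)) ℝ) :
    Matrix (Coalition d) (Coalition d) ℝ :=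
  1 - matU Q * (matU Q)ᵀ

/-- A probability distribution on the rows giving every row positive probability. -/
def IsSamplingDistribution {d : ℕ} (p : Coalition d → ℝ) : Prop :=
  (∀ S, 0 < p S) ∧ ∑ S, p S = 1

/-- `η = max_S ‖u_S‖² / p_S`, with `u_S` the `S`-th row of `U`. -/
def etaParam {d : ℕ} (Q : Matrix (Fin d) (Fin (d - 1)) ℝ) (p : Coalition d → ℝ) : ℝ :=
  ⨆ S, euclNorm (matU Q S) ^ 2 / p S

/-- `γ(z) = ∑_S (‖u_S‖² / p_S) z_S²`. -/
def gammaParam {d : ℕ} (Q : Matrix (Fin d) (Fin (d - 1)) ℝ) (p : Coalition d → ℝ)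
    (z : Coalition d → ℝ) : ℝ :=
  ∑ S, euclNorm (matU Q S) ^ 2 / p S * z S ^ 2

/-- The set of values of the regression estimator for the sketching matrix `A` (with rows indexed
by `ρ`): all vectors `Q x + α 1`, where `x` minimizes `‖A (U x - b_λ)‖²`. It is a singleton when
the least squares problem has a unique solution. -/
def regressionEstimates {d : ℕ} (Q : Matrix (Fin d) (Fin (d - 1)) ℝ) (v : Finset (Fin d) → ℝ)
    (lam : ℝ) {ρ : Type*} [Fintype ρ] (A : Matrix ρ (Coalition d) ℝ) : Set (Fin d → ℝ) :=
  {φ | ∃ x : Fin (d - 1) → ℝ,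
    (∀ y : Fin (d - 1) → ℝ, euclNorm (A *ᵥ (matU Q *ᵥ x - vecBLam v lam)) ^ 2 ≤
      euclNorm (A *ᵥ (matU Q *ᵥ y - vecBLam v lam)) ^ 2) ∧
    φ = Q *ᵥ x + fun _ => meanValue v}

/-- The matrix-vector estimator `Q Uᵀ Aᵀ A b_λ + α 1` for the sketching matrix `A`. -/
def matVecEstimate {d : ℕ} (Q : Matrix (Fin d) (Fin (d - 1)) ℝ) (v : Finset (Fin d) → ℝ)
    (lam : ℝ) {ρ : Type*} [Fintype ρ] (A : Matrix ρ (Coalition d) ℝ) : Fin d → ℝ :=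
  (Q * (matU Q)ᵀ * Aᵀ * A) *ᵥ vecBLam v lam + fun _ => meanValue v

/-- The regression estimator is defined and has error less than `ε`; if the least squares
problem has several solutions, the bound holds for each of them. -/
def RegressionAccurate {d : ℕ} (Q : Matrix (Fin d) (Fin (d - 1)) ℝ) (v : Finset (Fin d) → ℝ)
    (lam ε : ℝ) {ρ : Type*} [Fintype ρ] (A : Matrix ρ (Coalition d) ℝ) : Prop :=
  (regressionEstimates Q v lam A).Nonempty ∧
    ∀ φ ∈ regressionEstimates Q v lam A, euclNorm (shapley v - φ) < ε

/-- The matrix-vector estimator has error less than `ε`. -/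
def MatVecAccurate {d : ℕ} (Q : Matrix (Fin d) (Fin (d - 1)) ℝ) (v : Finset (Fin d) → ℝ)
    (lam ε : ℝ) {ρ : Type*} [Fintype ρ] (A : Matrix ρ (Coalition d) ℝ) : Prop :=
  euclNorm (shapley v - matVecEstimate Q v lam A) < ε

/-- `I_1, …, I_m` are independent and identically distributed with law `p`. -/
def IsReplacementSample {d m : ℕ} {Ω : Type*} [MeasurableSpace Ω] (μ : Measure Ω)
    (p : Coalition d → ℝ) (I : Fin m → Ω → Coalition d) : Prop :=
  (∀ j, Measurable (I j)) ∧ iIndepFun I μ ∧ ∀ j S, μ.real {ω | I j ω = S} = p S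

/-- The `m × (2 ^ d - 2)` sketching matrix for sampling with replacement: the only nonzero entry
of row `j` is in column `S = I_j` and equals `1 / √(m p_S)`. -/
def sketchReplacement {d m : ℕ} (p : Coalition d → ℝ) (I : Fin m → Coalition d) :
    Matrix (Fin m) (Coalition d) ℝ :=
  Matrix.of fun j S => if I j = S then 1 / Real.sqrt ((m : ℝ) * p S) else 0

/-- Coin flips `Y_S`, independent, with heads (`true`) of probability `q_S`. -/
def IsBernoulliSample {d : ℕ} {Ω : Type*} [MeasurableSpace Ω] (μ : Measure Ω)
    (q : Coalition d → ℝ) (Y : Coalition d → Ω → Bool) : Prop :=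
  (∀ S, Measurable (Y S)) ∧ iIndepFun Y μ ∧ ∀ S, μ.real {ω | Y S ω = true} = q S

/-- The sketching matrix for sampling without replacement: there is one row for each subset `S`
whose coin shows heads, with only nonzero entry `1 / √q_S` in column `S`. -/
def sketchBernoulli {d : ℕ} (q : Coalition d → ℝ) (Y : Coalition d → Bool) :
    Matrix {S : Coalition d // Y S = true} (Coalition d) ℝ :=
  Matrix.of fun R S => if R.1 = S then 1 / Real.sqrt (q S) else 0

end

/-! The Shapley values solve a least squares problem exactly: `U` has orthonormal columns
(`matU_transpose_mul_self`) and φ* = Q Uᵀ b_λ + α1 for every λ (`shapley_eq_mulVec_vecBLam`). Both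
facts follow from one linear formula for φ*, applied to additive games, whose Shapley values are
known; no entry of Z'ᵀZ' is ever computed.

For either sampling scheme AᵀA is a diagonal matrix D with expectation I. The matrix-vector error
has norm ‖Uᵀ(D - I)b_λ‖. For regression put r = P_U b_λ, so that Uᵀr = 0. If UᵀDU ≥ 1/4 as a
quadratic form, comparing a minimizer with Uᵀb_λ bounds the error by 8‖Uᵀ(D - I)r‖
(`regressionAccurate_of_euclNorm_lt`). The vector Uᵀ(D - I)z is a sum of independent centered terms
with second moment at most γ(z)/m, so Markov's inequality gives the γ/(δε²) terms.

The lower bound on UᵀDU is a matrix Chernoff bound, obtained without the Golden-Thompson or Lieb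
inequalities. A random rank-one increment aaᵀ with ‖a‖² ≤ 1/3 satisfies E tr exp(-(A + aaᵀ)) ≤ tr
exp(-A) - (1/2) tr(exp(-A) E aaᵀ) ≤ tr exp(-(A + (1/2) E aaᵀ)). The first inequality is
`sum_exp_neg_le_of_rankOne`, a second-order estimate in two eigenbases; the second is convexity,
`sum_exp_neg_ge`. Since this holds for every A, the independent increments can be replaced one at a
time (`sum_prod_mul_le_of_step`), giving E tr exp(-θ UᵀDU) ≤ (d - 1) exp(-θ/2). An eigenvalue of
UᵀDU below 1/4 makes this trace at least exp(-θ/4), and θ = 8 log(d/δ) makes that event rare. The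
increments are small enough once m ≥ 3ηθ, which is the η log(d/δ) term. -/

noncomputable section

open scoped InnerProductSpace

/-! ### Independent sums over finite outcome spaces, and Markov's inequality -/

/-- Replacing the summands of an independent random sum one at a time, when each replacement
increases the expectation of `Φ`. -/
theorem sum_prod_mul_le_of_step {V : Type*} [AddCommMonoid V] {K : Type*} [Fintype K] (Φ : V → ℝ)
    (J : Type*) [Fintype J] [DecidableEq J] (w : J → K → ℝ) (hw : ∀ j k, 0 ≤ w j k)
    (X : J → K → V) (D : J → V) (h : ∀ j A, ∑ k, w j k * Φ (A + X j k) ≤ Φ (A + D j)) (A : V) :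
    ∑ f : J → K, (∏ j, w j (f j)) * Φ (A + ∑ j, X j (f j)) ≤ Φ (A + ∑ j, D j) := by
  classical
  suffices H : ∀ (n : ℕ) (w : Fin n → K → ℝ) (_ : ∀ j k, 0 ≤ w j k)
      (X : Fin n → K → V) (D : Fin n → V)
      (_ : ∀ j A, ∑ k, w j k * Φ (A + X j k) ≤ Φ (A + D j)) (A : V),
      ∑ f : Fin n → K, (∏ j, w j (f j)) * Φ (A + ∑ j, X j (f j)) ≤ Φ (A + ∑ j, D j) by
    let e := Fintype.equivFin J
    have := H (Fintype.card J) (fun i => w (e.symm i)) (fun _ _ => hw _ _)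
      (fun i => X (e.symm i)) (fun i => D (e.symm i)) (fun _ _ => h _ _) A
    rw [e.symm.sum_comp] at this
    refine le_trans (le_of_eq ?_) this
    refine Fintype.sum_equiv (Equiv.arrowCongr e (Equiv.refl K)) _ _ fun f => ?_
    rw [← e.symm.prod_comp, ← e.symm.sum_comp]
    rfl
  intro n
  induction n with
  | zero => intro w _ X D _ A; simp
  | succ n ih =>
    intro w hw X D h A
    rw [← (Fin.consEquiv fun _ => K).sum_comp, Fintype.sum_prod_type]
    simp only [Fin.consEquiv_apply, Fin.prod_univ_succ, Fin.cons_zero, Fin.cons_succ,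
      Fin.sum_univ_succ]
    -- The later summands are replaced first, with `A + X 0 k` as base point; hence the induction
    -- over all `A`.
    calc _ = ∑ k, w 0 k * ∑ f : Fin n → K, (∏ j, w j.succ (f j)) *
          Φ (A + X 0 k + ∑ j, X j.succ (f j)) := by
          simp only [Finset.mul_sum, mul_assoc, add_assoc]
      _ ≤ ∑ k, w 0 k * Φ (A + X 0 k + ∑ j : Fin n, D j.succ) := by
          gcongr with k _
          · exact hw _ _
          · exact ih (fun j => w j.succ) (fun _ _ => hw _ _) (fun j => X j.succ)
              (fun j => D j.succ) (fun _ _ => h _ _) _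
      _ = ∑ k, w 0 k * Φ ((A + ∑ j : Fin n, D j.succ) + X 0 k) := by
          simp only [add_right_comm]
      _ ≤ Φ ((A + ∑ j : Fin n, D j.succ) + D 0) := h 0 _
      _ = _ := by rw [add_assoc, add_comm (∑ j : Fin n, D j.succ)]

/-- Variances of independent centered vectors add. An extra real coordinate accumulates the variance
bounds `D j`, so that the one-at-a-time replacement applies to Φ(x, t) = x ⬝ᵥ x + t. -/
theorem sum_prod_mul_dotProduct_self_le {n K J : Type*} [Fintype n] [Fintype K] [Fintype J] [DecidableEq J]
    (w : J → K → ℝ) (hw : ∀ j k, 0 ≤ w j k) (hw1 : ∀ j, ∑ k, w j k = 1)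
    (X : J → K → n → ℝ) (D : J → ℝ) (hX : ∀ j, ∑ k, w j k • X j k = 0)
    (hD : ∀ j, ∑ k, w j k * (X j k ⬝ᵥ X j k) ≤ D j) :
    ∑ f : J → K, (∏ j, w j (f j)) * ((∑ j, X j (f j)) ⬝ᵥ ∑ j, X j (f j)) ≤ ∑ j, D j := by
  have := sum_prod_mul_le_of_step (V := (n → ℝ) × ℝ) (fun x => x.1 ⬝ᵥ x.1 + x.2) J w hw
    (fun j k => (X j k, 0)) (fun j => (0, D j)) ?_ 0
  · simpa [Prod.fst_sum, Prod.snd_sum] using this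
  intro j A
  have h1 : ∑ k, w j k * (A.1 ⬝ᵥ X j k) = 0 := by
    have := congrArg (fun y => A.1 ⬝ᵥ y) (hX j)
    simpa [dotProduct_sum, dotProduct_smul] using this
  have h2 : ∀ k, w j k * ((A + (X j k, (0 : ℝ))).1 ⬝ᵥ (A + (X j k, (0 : ℝ))).1 +
      (A + (X j k, (0 : ℝ))).2) = w j k * (A.1 ⬝ᵥ A.1 + A.2) + 2 * (w j k * (A.1 ⬝ᵥ X j k)) +
        w j k * (X j k ⬝ᵥ X j k) := by
    intro k
    simp only [Prod.fst_add, Prod.snd_add, add_dotProduct, dotProduct_add,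
      dotProduct_comm (X j k) A.1]
    ring
  simp only [h2, Finset.sum_add_distrib, ← Finset.mul_sum, ← Finset.sum_mul, hw1, h1]
  simp only [Prod.fst_add, Prod.snd_add, add_zero]
  linarith [hD j]

theorem measureReal_forall_eq {J K Ω : Type*} [Fintype J] [MeasurableSpace K]
    [MeasurableSingletonClass K] [MeasurableSpace Ω] (μ : Measure Ω) [IsProbabilityMeasure μ]
    (Y : J → Ω → K) (hi : iIndepFun Y μ) (f : J → K) :
    μ.real {ω | (fun j => Y j ω) = f} = ∏ j, μ.real {ω | Y j ω = f j} := by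
  have := hi.measure_inter_preimage_eq_mul Finset.univ (sets := fun j => {f j})
    (fun j _ => measurableSet_singleton _)
  simp only [Measure.real]
  rw [← ENNReal.toReal_prod]
  congr 1
  refine Eq.trans ?_ this
  congr 1
  · ext ω
    simp [funext_iff]

/-- If `F` is at least one outside of the event `G` and has expectation less than `δ`, then `G`
has probability more than `1 - δ`. -/
theorem one_sub_lt_measureReal_of_sum_lt {J K Ω : Type*} [Fintype J] [DecidableEq J] [Fintype K]
    [MeasurableSpace K]
    [MeasurableSingletonClass K] [MeasurableSpace Ω] (μ : Measure Ω) [IsProbabilityMeasure μ]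
    (Y : J → Ω → K) (hm : ∀ j, Measurable (Y j)) (hi : iIndepFun Y μ) (w : J → K → ℝ)
    (hw : ∀ j k, μ.real {ω | Y j ω = k} = w j k) (G : (J → K) → Prop) (F : (J → K) → ℝ)
    (hF : ∀ f, 0 ≤ F f) (hF1 : ∀ f, ¬ G f → 1 ≤ F f) {δ : ℝ}
    (h : ∑ f : J → K, (∏ j, w j (f j)) * F f < δ) :
    1 - δ < μ.real {ω | G fun j => Y j ω} := by
  classical
  have hms : ∀ P : (J → K) → Prop, MeasurableSet {ω | P fun j => Y j ω} := fun P =>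
    measurable_pi_lambda (fun ω j => Y j ω) hm (Set.toFinite {f | P f}).measurableSet
  have hbad : μ.real {ω | ¬ G fun j => Y j ω} < δ := by
    refine lt_of_le_of_lt ?_ h
    have hU : {ω | ¬ G fun j => Y j ω} ⊆
        ⋃ f ∈ Finset.univ.filter (fun f : J → K => ¬ G f), {ω | (fun j => Y j ω) = f} := by
      intro ω hω
      simpa using hω
    calc _ ≤ _ := measureReal_mono hU (measure_ne_top _ _)
      _ ≤ ∑ f ∈ Finset.univ.filter (fun f : J → K => ¬ G f), μ.real {ω | (fun j => Y j ω) = f} :=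
          measureReal_biUnion_finset_le _ _
      _ ≤ ∑ f ∈ Finset.univ.filter (fun f : J → K => ¬ G f), (∏ j, w j (f j)) * F f := by
          refine Finset.sum_le_sum fun f hf => ?_
          rw [measureReal_forall_eq μ Y hi f]
          simp only [hw]
          refine le_mul_of_one_le_right (Finset.prod_nonneg fun j _ => ?_)
            (hF1 f (Finset.mem_filter.1 hf).2)
          rw [← hw]; exact measureReal_nonneg
      _ ≤ _ := by
          refine Finset.sum_le_sum_of_subset_of_nonneg (Finset.filter_subset _ _) fun f _ _ =>
            mul_nonneg (Finset.prod_nonneg fun j _ => ?_) (hF f)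
          rw [← hw]; exact measureReal_nonneg
  have hc := measureReal_compl (μ := μ) (hms fun f => ¬ G f)
  simp only [probReal_univ] at hc
  have : {ω | ¬ G fun j => Y j ω}ᶜ = {ω | G fun j => Y j ω} := by ext; simp
  rw [this] at hc
  linarith

/-! ### Exponential sums over the spectra of two symmetric operators -/

/-- The remainder carries the factor exp(-x) so that the bound holds for all real x. With x = β - α
and after multiplication by exp(-α), that remainder is weighted by exp(-β), the weight of the other
spectrum. -/
theorem exp_neg_le_taylor (x : ℝ) :
    Real.exp (-x) ≤ 1 - x + x ^ 2 / 2 + x ^ 2 * Real.exp (-x) := by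
  have hpos := Real.exp_pos (-x)
  have hmul : Real.exp x * Real.exp (-x) = 1 := by rw [← Real.exp_add]; simp
  rcases le_total 0 x with hx | hx
  · have h := mul_le_mul_of_nonneg_right (Real.quadratic_le_exp_of_nonneg hx) hpos.le
    -- (1 + x + x²/2)(1 - x + x²/2) = 1 + x⁴/4 ≥ 1.
    have h4 : Real.exp (-x) ≤ 1 - x + x ^ 2 / 2 := by
      nlinarith [mul_nonneg (pow_nonneg hx 4) hpos.le,
        mul_le_mul_of_nonneg_right h (by nlinarith [sq_nonneg (x - 1)] : 0 ≤ 1 - x + x ^ 2 / 2)]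
    nlinarith [mul_nonneg (sq_nonneg x) hpos.le]
  · rcases le_total x (-1) with h1 | h1
    · nlinarith [mul_nonneg (by nlinarith : 0 ≤ x ^ 2 - 1) hpos.le, sq_nonneg x]
    · have h : (1 + x) * Real.exp (-x) ≤ 1 := by
        nlinarith [Real.add_one_le_exp x]
      have hq : 1 - x ^ 2 ≤ (1 - x + x ^ 2 / 2) * (1 + x) := by
        nlinarith [mul_nonneg (sq_nonneg x) (by linarith : 0 ≤ 1 + x)]
      nlinarith [mul_le_mul_of_nonneg_right hq hpos.le,
        mul_le_mul_of_nonneg_left h (by nlinarith [sq_nonneg x] : 0 ≤ 1 - x + x ^ 2 / 2)]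

section TwoBases
variable {n E : Type*} [Fintype n] [NormedAddCommGroup E] [InnerProductSpace ℝ E]

/-- Here `h` says that the operators with eigenpairs (α, u) and (β, v) differ by aaᵀ. The squares ⟪u
i, v j⟫² form a doubly stochastic matrix, under which the gaps β j - α i have explicit first and
second moments along rows and columns. The scalar Taylor bound, averaged against this matrix, then
gives the claim. -/
theorem sum_exp_neg_le_of_rankOne (u v : OrthonormalBasis n ℝ E) (α β : n → ℝ) (a : E)
    (h : ∀ i j, (β j - α i) * ⟪u i, v j⟫_ℝ = ⟪u i, a⟫_ℝ * ⟪a, v j⟫_ℝ) :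
    ∑ j, Real.exp (-β j) ≤ ∑ i, Real.exp (-α i) -
      (1 - 3 / 2 * ‖a‖ ^ 2) * ∑ i, Real.exp (-α i) * ⟪u i, a⟫_ℝ ^ 2 := by
  have rowU : ∀ x : E, ∑ i, ⟪u i, x⟫_ℝ ^ 2 = ‖x‖ ^ 2 := fun x => by
    simpa using u.sum_sq_norm_inner_right x
  have rowV : ∀ x : E, ∑ i, ⟪x, v i⟫_ℝ ^ 2 = ‖x‖ ^ 2 := fun x => by
    simpa using v.sum_sq_norm_inner_left x
  have hu : ∀ i, ‖u i‖ ^ 2 = 1 := fun i => by simp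
  have hv : ∀ i, ‖v i‖ ^ 2 = 1 := fun i => by simp
  set p : n → n → ℝ := fun i j => ⟪u i, v j⟫_ℝ ^ 2 with hp
  have hp0 : ∀ i j, 0 ≤ p i j := fun i j => sq_nonneg _
  have hx1 : ∀ i, ∑ j, p i j * (β j - α i) = ⟪u i, a⟫_ℝ ^ 2 := by
    intro i
    calc _ = ∑ j, ⟪u i, a⟫_ℝ * (⟪u i, v j⟫_ℝ * ⟪v j, a⟫_ℝ) := by
          refine Finset.sum_congr rfl fun j _ => ?_
          rw [real_inner_comm a (v j)]
          linear_combination ⟪u i, v j⟫_ℝ * h i j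
      _ = _ := by rw [← Finset.mul_sum, v.sum_inner_mul_inner, sq]
  have hy1 : ∀ j, ∑ i, p i j * (β j - α i) = ⟪a, v j⟫_ℝ ^ 2 := by
    intro j
    calc _ = ∑ i, ⟪a, v j⟫_ℝ * (⟪a, u i⟫_ℝ * ⟪u i, v j⟫_ℝ) := by
          refine Finset.sum_congr rfl fun i _ => ?_
          rw [real_inner_comm (u i) a]
          linear_combination ⟪u i, v j⟫_ℝ * h i j
      _ = _ := by rw [← Finset.mul_sum, u.sum_inner_mul_inner, sq]
  have hx2 : ∀ i, ∑ j, p i j * (β j - α i) ^ 2 = ⟪u i, a⟫_ℝ ^ 2 * ‖a‖ ^ 2 := by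
    intro i
    rw [← rowV a, Finset.mul_sum]
    refine Finset.sum_congr rfl fun j _ => ?_
    rw [← mul_pow ⟪u i, a⟫_ℝ, ← h i j]; simp only [hp]; ring
  have hy2 : ∀ j, ∑ i, p i j * (β j - α i) ^ 2 = ‖a‖ ^ 2 * ⟪a, v j⟫_ℝ ^ 2 := by
    intro j
    rw [← rowU a, Finset.sum_mul]
    refine Finset.sum_congr rfl fun i _ => ?_
    rw [← mul_pow ⟪u i, a⟫_ℝ, ← h i j]; simp only [hp]; ring
  have hrow : ∀ i, ∑ j, p i j = 1 := fun i => by rw [← hu i, ← rowV (u i)]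
  have hcol : ∀ j, ∑ i, p i j = 1 := fun j => by rw [← hv j, ← rowU (v j)]
  -- sums of the form `∑ p f` in both orders
  have hA : ∀ g : n → n → ℝ, ∑ i, ∑ j, p i j * (Real.exp (-α i) * g i j) =
      ∑ i, Real.exp (-α i) * ∑ j, p i j * g i j := fun g => by
    refine Finset.sum_congr rfl fun i _ => ?_
    rw [Finset.mul_sum]; exact Finset.sum_congr rfl fun j _ => by ring
  have hB : ∀ g : n → n → ℝ, ∑ i, ∑ j, p i j * (Real.exp (-β j) * g i j) =
      ∑ j, Real.exp (-β j) * ∑ i, p i j * g i j := fun g => by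
    rw [Finset.sum_comm]
    refine Finset.sum_congr rfl fun i _ => ?_
    rw [Finset.mul_sum]; exact Finset.sum_congr rfl fun j _ => by ring
  set SA := ∑ i, Real.exp (-α i) * ⟪u i, a⟫_ℝ ^ 2
  set SB := ∑ j, Real.exp (-β j) * ⟪a, v j⟫_ℝ ^ 2
  have A0 := hA fun _ _ => 1
  have A1 := hA fun i j => β j - α i
  have A2 := hA fun i j => (β j - α i) ^ 2
  have B0 := hB fun _ _ => 1
  have B1 := hB fun i j => β j - α i
  have B2 := hB fun i j => (β j - α i) ^ 2
  simp only [mul_one, hrow, hcol, hx1, hx2, hy1, hy2] at A0 A1 A2 B0 B1 B2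
  change _ = SA at A1
  change _ = SB at B1
  have A2' : ∑ i, ∑ j, p i j * (Real.exp (-α i) * (β j - α i) ^ 2) = ‖a‖ ^ 2 * SA := by
    rw [A2, Finset.mul_sum]; exact Finset.sum_congr rfl fun _ _ => by ring
  have B2' : ∑ i, ∑ j, p i j * (Real.exp (-β j) * (β j - α i) ^ 2) = ‖a‖ ^ 2 * SB := by
    rw [B2, Finset.mul_sum]; exact Finset.sum_congr rfl fun _ _ => by ring
  -- The product x (exp(-α) - exp(-β)) with x = β - α is nonnegative, because exp(-·) is decreasing.
  -- This turns ‖a‖² (SA/2 + SB) into (3/2)‖a‖² SA.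
  have hmono : SB ≤ SA := by
    rw [← A1, ← B1]
    refine Finset.sum_le_sum fun i _ => Finset.sum_le_sum fun j _ =>
      mul_le_mul_of_nonneg_left ?_ (hp0 i j)
    rcases le_total (α i) (β j) with hab | hab
    · exact mul_le_mul_of_nonneg_right (Real.exp_le_exp.2 (by linarith)) (by linarith)
    · exact mul_le_mul_of_nonpos_right (Real.exp_le_exp.2 (by linarith)) (by linarith)
  have hmain : ∑ j, Real.exp (-β j) ≤ ∑ i, Real.exp (-α i) - SA + ‖a‖ ^ 2 * SA / 2 +
      ‖a‖ ^ 2 * SB := by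
    rw [← A2', ← B2', ← A0, ← B0, ← A1]
    simp only [Finset.sum_div, ← Finset.sum_add_distrib, ← Finset.sum_sub_distrib]
    refine Finset.sum_le_sum fun i _ => Finset.sum_le_sum fun j _ => ?_
    have e : Real.exp (-β j) = Real.exp (-α i) * Real.exp (-(β j - α i)) := by
      rw [← Real.exp_add]; ring_nf
    have := mul_le_mul_of_nonneg_left (exp_neg_le_taylor (β j - α i))
      (mul_nonneg (hp0 i j) (Real.exp_pos (-α i)).le)
    rw [e]
    refine le_trans (le_of_eq (by ring)) (this.trans (le_of_eq (by ring)))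
  nlinarith [mul_le_mul_of_nonneg_left hmono (sq_nonneg ‖a‖)]

/-- Convexity of the trace exponential: the tangent line of exp(-·) at α i lies below exp(-β j), and
averaging over the doubly stochastic ⟪u i, v j⟫² yields the matrix inequality. -/
theorem sum_exp_neg_ge (u v : OrthonormalBasis n ℝ E) (α β : n → ℝ) :
    ∑ i, Real.exp (-α i) - ∑ i, Real.exp (-α i) * (∑ j, β j * ⟪u i, v j⟫_ℝ ^ 2 - α i) ≤
      ∑ j, Real.exp (-β j) := by
  have hrow : ∀ i, ∑ j, ⟪u i, v j⟫_ℝ ^ 2 = 1 := fun i => by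
    simpa using v.sum_sq_norm_inner_left (u i)
  have hcol : ∀ j, ∑ i, ⟪u i, v j⟫_ℝ ^ 2 = 1 := fun j => by
    simpa using u.sum_sq_norm_inner_right (v j)
  have e1 : ∑ j, Real.exp (-β j) = ∑ i, ∑ j, ⟪u i, v j⟫_ℝ ^ 2 * Real.exp (-β j) := by
    rw [Finset.sum_comm]
    simp [← Finset.sum_mul, hcol]
  rw [e1, ← Finset.sum_sub_distrib]
  refine Finset.sum_le_sum fun i _ => ?_
  have e2 : Real.exp (-α i) - Real.exp (-α i) * (∑ j, β j * ⟪u i, v j⟫_ℝ ^ 2 - α i) =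
      ∑ j, ⟪u i, v j⟫_ℝ ^ 2 * (Real.exp (-α i) * (1 - (β j - α i))) := by
    have : ∀ j, ⟪u i, v j⟫_ℝ ^ 2 * (Real.exp (-α i) * (1 - (β j - α i))) =
        Real.exp (-α i) * (1 + α i) * ⟪u i, v j⟫_ℝ ^ 2 -
          Real.exp (-α i) * (β j * ⟪u i, v j⟫_ℝ ^ 2) := fun j => by ring
    simp only [this, Finset.sum_sub_distrib, ← Finset.mul_sum, hrow]
    ring
  rw [e2]
  refine Finset.sum_le_sum fun j _ => mul_le_mul_of_nonneg_left ?_ (sq_nonneg _)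
  have e : Real.exp (-β j) = Real.exp (-α i) * Real.exp (-(β j - α i)) := by
    rw [← Real.exp_add]; ring_nf
  rw [e]
  refine mul_le_mul_of_nonneg_left ?_ (Real.exp_pos _).le
  linarith [Real.add_one_le_exp (-(β j - α i))]
end TwoBases

/-! ### The trace of exp(-A) under rank-one increments -/

section ExpTrace
variable {n : Type*}

theorem isHermitian_coe (A : selfAdjoint (Matrix n n ℝ)) : (A : Matrix n n ℝ).IsHermitian :=
  selfAdjoint.mem_iff.1 A.2

/-- The matrix `a aᵀ`. -/
def selfOuter (a : n → ℝ) : selfAdjoint (Matrix n n ℝ) :=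
  ⟨vecMulVec a a, selfAdjoint.mem_iff.2 (by ext i j; simp [star_apply, vecMulVec_apply, mul_comm])⟩

theorem coe_selfOuter (a : n → ℝ) : (selfOuter a : Matrix n n ℝ) = vecMulVec a a := rfl

variable [Fintype n]

theorem inner_eq_dotProduct (x y : EuclideanSpace ℝ n) :
    inner ℝ x y = WithLp.ofLp x ⬝ᵥ WithLp.ofLp y := by
  rw [EuclideanSpace.inner_eq_star_dotProduct, star_trivial, dotProduct_comm]

theorem dotProduct_vecMulVec_mulVec (a x y : n → ℝ) :
    x ⬝ᵥ vecMulVec a a *ᵥ y = (x ⬝ᵥ a) * (a ⬝ᵥ y) := by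
  rw [vecMulVec_mulVec]
  simp [dotProduct_smul, mul_comm]

theorem norm_toLp_sq (a : n → ℝ) : ‖WithLp.toLp 2 a‖ ^ 2 = a ⬝ᵥ a := by
  rw [← real_inner_self_eq_norm_sq, inner_eq_dotProduct]

theorem dotProduct_mulVec_comm (A : selfAdjoint (Matrix n n ℝ)) (x y : n → ℝ) :
    x ⬝ᵥ (A : Matrix n n ℝ) *ᵥ y = ((A : Matrix n n ℝ) *ᵥ x) ⬝ᵥ y := by
  have h : (A : Matrix n n ℝ)ᵀ = A := by
    have := isHermitian_coe A
    rwa [IsHermitian, conjTranspose_eq_transpose_of_trivial] at this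
  rw [dotProduct_mulVec, ← mulVec_transpose, h]

variable [DecidableEq n]

/-- The `i`-th vector of an orthonormal basis of eigenvectors of `A`. -/
def eigenvec (A : selfAdjoint (Matrix n n ℝ)) (i : n) : n → ℝ :=
  WithLp.ofLp ((isHermitian_coe A).eigenvectorBasis i)

/-- The `i`-th eigenvalue of `A`. -/
def eigenval (A : selfAdjoint (Matrix n n ℝ)) (i : n) : ℝ := (isHermitian_coe A).eigenvalues i

/-- The trace of `exp (-A)`. -/
def expTrace (A : selfAdjoint (Matrix n n ℝ)) : ℝ := ∑ i, Real.exp (-eigenval A i)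

/-- The trace of `exp (-A) * D`. -/
def expTraceMul (A : selfAdjoint (Matrix n n ℝ)) (D : Matrix n n ℝ) : ℝ :=
  ∑ i, Real.exp (-eigenval A i) * (eigenvec A i ⬝ᵥ D *ᵥ eigenvec A i)

theorem mulVec_eigenvec (A : selfAdjoint (Matrix n n ℝ)) (i : n) :
    (A : Matrix n n ℝ) *ᵥ eigenvec A i = eigenval A i • eigenvec A i :=
  (isHermitian_coe A).mulVec_eigenvectorBasis i

theorem sum_dotProduct_eigenvec_sq (A : selfAdjoint (Matrix n n ℝ)) (x : n → ℝ) :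
    ∑ i, (x ⬝ᵥ eigenvec A i) ^ 2 = x ⬝ᵥ x := by
  have := (isHermitian_coe A).eigenvectorBasis.sum_sq_norm_inner_left (WithLp.toLp 2 x)
  simpa [norm_toLp_sq, inner_eq_dotProduct, eigenvec] using this

theorem eigenvec_dotProduct_self (A : selfAdjoint (Matrix n n ℝ)) (i : n) :
    eigenvec A i ⬝ᵥ eigenvec A i = 1 := by
  rw [eigenvec, ← inner_eq_dotProduct]
  simp

theorem dotProduct_mulVec_self_eq_sum (A : selfAdjoint (Matrix n n ℝ)) (x : n → ℝ) :
    x ⬝ᵥ (A : Matrix n n ℝ) *ᵥ x = ∑ i, eigenval A i * (x ⬝ᵥ eigenvec A i) ^ 2 := by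
  have := (isHermitian_coe A).eigenvectorBasis.sum_inner_mul_inner
    (WithLp.toLp 2 ((A : Matrix n n ℝ) *ᵥ x)) (WithLp.toLp 2 x)
  simp only [inner_eq_dotProduct] at this
  rw [dotProduct_comm, ← this]
  refine Finset.sum_congr rfl fun i _ => ?_
  change ((A : Matrix n n ℝ) *ᵥ x) ⬝ᵥ eigenvec A i * (eigenvec A i ⬝ᵥ x) = _
  rw [← dotProduct_mulVec_comm, mulVec_eigenvec, dotProduct_smul, dotProduct_comm (eigenvec A i) x,
    smul_eq_mul]
  ring

/-- The threshold 1/3 is what makes 1 - (3/2)‖a‖² at least 1/2. -/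
theorem expTrace_add_selfOuter_le (A : selfAdjoint (Matrix n n ℝ)) (a : n → ℝ)
    (ha : a ⬝ᵥ a ≤ 1 / 3) :
    expTrace (A + selfOuter a) ≤ expTrace A - 1 / 2 * expTraceMul A (vecMulVec a a) := by
  have key := sum_exp_neg_le_of_rankOne (isHermitian_coe A).eigenvectorBasis
    (isHermitian_coe (A + selfOuter a)).eigenvectorBasis (eigenval A)
    (eigenval (A + selfOuter a)) (WithLp.toLp 2 a) (by
      intro i j
      simp only [inner_eq_dotProduct]
      change _ * (eigenvec A i ⬝ᵥ eigenvec (A + selfOuter a) j) =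
        (eigenvec A i ⬝ᵥ a) * (a ⬝ᵥ eigenvec (A + selfOuter a) j)
      have h := congrArg (fun y => eigenvec A i ⬝ᵥ y) (mulVec_eigenvec (A + selfOuter a) j)
      simp only [AddSubgroup.coe_add, add_mulVec, dotProduct_add, dotProduct_smul, coe_selfOuter,
        dotProduct_vecMulVec_mulVec, dotProduct_mulVec_comm, mulVec_eigenvec, smul_dotProduct,
        smul_eq_mul] at h
      linarith)
  rw [norm_toLp_sq] at key
  have e : ∑ i, Real.exp (-eigenval A i) * inner ℝ ((isHermitian_coe A).eigenvectorBasis i)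
      (WithLp.toLp 2 a) ^ 2 = expTraceMul A (vecMulVec a a) := by
    refine Finset.sum_congr rfl fun i _ => ?_
    rw [dotProduct_vecMulVec_mulVec, inner_eq_dotProduct, dotProduct_comm a, sq]
    rfl
  rw [e] at key
  have h0 : 0 ≤ expTraceMul A (vecMulVec a a) := by
    rw [← e]; positivity
  refine key.trans ?_
  simp only [expTrace]
  nlinarith

theorem expTrace_sub_expTraceMul_le (A D : selfAdjoint (Matrix n n ℝ)) :
    expTrace A - expTraceMul A D ≤ expTrace (A + D) := by
  refine le_trans (le_of_eq ?_) (sum_exp_neg_ge (isHermitian_coe A).eigenvectorBasis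
    (isHermitian_coe (A + D)).eigenvectorBasis (eigenval A) (eigenval (A + D)))
  rw [expTrace, expTraceMul]
  congr 1
  refine Finset.sum_congr rfl fun i _ => ?_
  congr 1
  have h := dotProduct_mulVec_self_eq_sum (A + D) (eigenvec A i)
  simp only [AddSubgroup.coe_add, add_mulVec, dotProduct_add, mulVec_eigenvec, dotProduct_smul,
    eigenvec_dotProduct_self, smul_eq_mul, mul_one] at h
  simp only [inner_eq_dotProduct]
  exact eq_sub_of_add_eq' h

theorem expTraceMul_sum_smul {K : Type*} [Fintype K] (A : selfAdjoint (Matrix n n ℝ))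
    (w : K → ℝ) (D : K → Matrix n n ℝ) :
    expTraceMul A (∑ k, w k • D k) = ∑ k, w k * expTraceMul A (D k) := by
  simp only [expTraceMul, sum_mulVec, dotProduct_sum, smul_mulVec, dotProduct_smul, smul_eq_mul,
    Finset.mul_sum]
  rw [Finset.sum_comm]
  exact Finset.sum_congr rfl fun _ _ => Finset.sum_congr rfl fun _ _ => by ring

theorem expTraceMul_smul (A : selfAdjoint (Matrix n n ℝ)) (c : ℝ) (D : Matrix n n ℝ) :
    expTraceMul A (c • D) = c * expTraceMul A D := by
  simpa using expTraceMul_sum_smul (K := Unit) A (fun _ => c) (fun _ => D)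

theorem expTraceMul_vecMulVec_nonneg (A : selfAdjoint (Matrix n n ℝ)) (a : n → ℝ) :
    0 ≤ expTraceMul A (vecMulVec a a) := by
  refine Finset.sum_nonneg fun i _ => mul_nonneg (Real.exp_pos _).le ?_
  rw [dotProduct_vecMulVec_mulVec, dotProduct_comm a]
  exact mul_self_nonneg _

/-- Averaging a small random rank-one increment decreases the trace of `exp (-A)` at least as much
as adding half of its mean. -/
theorem sum_mul_expTrace_add_selfOuter_le {K : Type*} [Fintype K] (w : K → ℝ) (hw : ∀ k, 0 ≤ w k)
    (hw1 : ∑ k, w k = 1) (a : K → n → ℝ) (ha : ∀ k, w k ≠ 0 → a k ⬝ᵥ a k ≤ 1 / 3)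
    (A D : selfAdjoint (Matrix n n ℝ))
    (hD : (D : Matrix n n ℝ) = (1 / 2 : ℝ) • ∑ k, w k • vecMulVec (a k) (a k)) :
    ∑ k, w k * expTrace (A + selfOuter (a k)) ≤ expTrace (A + D) := by
  refine le_trans ?_ (expTrace_sub_expTraceMul_le A D)
  rw [hD, expTraceMul_smul, expTraceMul_sum_smul]
  calc _ ≤ ∑ k, w k * (expTrace A - 1 / 2 * expTraceMul A (vecMulVec (a k) (a k))) := by
        refine Finset.sum_le_sum fun k _ => ?_
        by_cases hk : w k = 0
        · simp [hk]
        · exact mul_le_mul_of_nonneg_left (expTrace_add_selfOuter_le A (a k) (ha k hk)) (hw k)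
    _ = _ := by
        simp only [mul_sub, Finset.sum_sub_distrib, ← Finset.sum_mul, hw1, one_mul,
          Finset.mul_sum]
        congr 1
        exact Finset.sum_congr rfl fun _ _ => by ring

/-- Monotonicity, from the tangent inequality at A + aaᵀ in the direction -aaᵀ/2. No bound on `a` is
needed; this serves the rows that are sampled with probability one. -/
theorem expTrace_add_selfOuter_le_half (A : selfAdjoint (Matrix n n ℝ)) (a : n → ℝ) :
    expTrace (A + selfOuter a) ≤ expTrace (A + (1 / 2 : ℝ) • selfOuter a) := by
  have h := expTrace_sub_expTraceMul_le (A + selfOuter a) ((-1 / 2 : ℝ) • selfOuter a)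
  have e : A + selfOuter a + (-1 / 2 : ℝ) • selfOuter a = A + (1 / 2 : ℝ) • selfOuter a := by
    module
  rw [e, selfAdjoint.val_smul, expTraceMul_smul] at h
  have := expTraceMul_vecMulVec_nonneg (A + selfOuter a) a
  rw [coe_selfOuter] at h
  linarith

theorem expTrace_of_coe_eq_smul_one (A : selfAdjoint (Matrix n n ℝ)) (c : ℝ)
    (h : (A : Matrix n n ℝ) = c • 1) : expTrace A = Fintype.card n * Real.exp (-c) := by
  have : ∀ i, eigenval A i = c := fun i => by
    have h1 := congrArg (fun y => eigenvec A i ⬝ᵥ y) (mulVec_eigenvec A i)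
    simpa [h, smul_mulVec, dotProduct_smul, eigenvec_dotProduct_self] using h1.symm
  simp [expTrace, this]

theorem expTrace_nonneg (A : selfAdjoint (Matrix n n ℝ)) : 0 ≤ expTrace A :=
  Finset.sum_nonneg fun _ _ => (Real.exp_pos _).le

theorem exp_neg_le_expTrace (A : selfAdjoint (Matrix n n ℝ)) (c : ℝ) (x : n → ℝ)
    (h : x ⬝ᵥ (A : Matrix n n ℝ) *ᵥ x < c * (x ⬝ᵥ x)) : Real.exp (-c) ≤ expTrace A := by
  have : ∃ i, eigenval A i < c := by
    by_contra! hc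
    rw [dotProduct_mulVec_self_eq_sum, ← sum_dotProduct_eigenvec_sq A x, Finset.mul_sum] at h
    exact absurd h (not_lt.2 (Finset.sum_le_sum fun i _ =>
      mul_le_mul_of_nonneg_right (hc i) (sq_nonneg _)))
  obtain ⟨i, hi⟩ := this
  exact (Real.exp_le_exp.2 (by linarith)).trans
    (Finset.single_le_sum (f := fun i => Real.exp (-eigenval A i))
      (fun _ _ => (Real.exp_pos _).le) (Finset.mem_univ i))
end ExpTrace

/-! ### Shapley values as an exact least squares solution -/

/-- The coefficient `s! (d - s - 1)! / d!` of the Shapley values. -/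
def shapleyCoeff (d s : ℕ) : ℝ :=
  (s.factorial : ℝ) * ((d - s - 1).factorial : ℝ) / (d.factorial : ℝ)

theorem sum_powerset_erase_eq_sum_mem {d : ℕ} (j : Fin d) (f : Finset (Fin d) → ℝ) :
    ∑ S ∈ (Finset.univ.erase j).powerset, f (insert j S) =
      ∑ S : Finset (Fin d), if j ∈ S then f S else 0 := by
  rw [← Finset.sum_filter]
  refine Finset.sum_bij' (fun S _ => insert j S) (fun S _ => S.erase j) ?_ ?_ ?_ ?_ ?_
  · intro S _; simp
  · intro S _; simpa using Finset.erase_subset_erase j (Finset.subset_univ S)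
  · intro S hS
    refine Finset.erase_insert fun h => ?_
    simpa using Finset.mem_powerset.1 hS h
  · intro S hS; exact Finset.insert_erase (Finset.mem_filter.1 hS).2
  · intro S _; rfl

theorem sum_powerset_erase_eq_sum_notMem {d : ℕ} (j : Fin d) (f : Finset (Fin d) → ℝ) :
    ∑ S ∈ (Finset.univ.erase j).powerset, f S =
      ∑ S : Finset (Fin d), if j ∈ S then 0 else f S := by
  have : (Finset.univ.erase j).powerset = Finset.univ.filter fun S : Finset (Fin d) => j ∉ S := by
    ext S
    simp only [Finset.mem_powerset, Finset.mem_filter, Finset.mem_univ, true_and]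
    exact ⟨fun h hj => by simpa using h hj, fun h x hx => by
      simp only [Finset.mem_erase, Finset.mem_univ, and_true]; rintro rfl; exact h hx⟩
  rw [this, Finset.sum_filter]
  exact Finset.sum_congr rfl fun S _ => by by_cases h : j ∈ S <;> simp [h]

/-- Subtracting `v ∅` from every value leaves the marginal contributions unchanged and removes the
term of the empty set. -/
theorem shapley_eq_sum_univ {d : ℕ} (v : Finset (Fin d) → ℝ) (j : Fin d) :
    shapley v j = ∑ S : Finset (Fin d),
      (if j ∈ S then shapleyCoeff d (S.card - 1) else -shapleyCoeff d S.card) * (v S - v ∅) := by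
  have h1 : shapley v j = ∑ S ∈ (Finset.univ.erase j).powerset,
      (fun T : Finset (Fin d) => shapleyCoeff d (T.card - 1) * (v T - v ∅)) (insert j S) -
      ∑ S ∈ (Finset.univ.erase j).powerset, shapleyCoeff d S.card * (v S - v ∅) := by
    rw [← Finset.sum_sub_distrib]
    refine Finset.sum_congr rfl fun S hS => ?_
    have : j ∉ S := fun h => by simpa using Finset.mem_powerset.1 hS h
    simp only [Finset.card_insert_of_notMem this, Nat.add_sub_cancel, shapleyCoeff]
    ring
  have h2 := sum_powerset_erase_eq_sum_mem j
    fun T : Finset (Fin d) => shapleyCoeff d (T.card - 1) * (v T - v ∅)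
  rw [h1, h2, sum_powerset_erase_eq_sum_notMem, ← Finset.sum_sub_distrib]
  refine Finset.sum_congr rfl fun S _ => ?_
  by_cases h : j ∈ S <;> simp [h]

theorem sum_eq_sum_coalition {d : ℕ} (hd : 2 ≤ d) (f : Finset (Fin d) → ℝ) :
    ∑ S, f S = f ∅ + f Finset.univ + ∑ S : Coalition d, f S.1 := by
  have : Nonempty (Fin d) := ⟨⟨0, by omega⟩⟩
  have hne : (∅ : Finset (Fin d)) ≠ Finset.univ := Finset.univ_nonempty.ne_empty.symm
  rw [← Finset.sum_subtype (Finset.univ.filter fun S : Finset (Fin d) => S ≠ ∅ ∧ S ≠ Finset.univ)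
    (by simp) f, ← Finset.sum_pair hne, ← Finset.sum_filter_add_sum_filter_not Finset.univ
      (fun S : Finset (Fin d) => S ≠ ∅ ∧ S ≠ Finset.univ), add_comm]
  congr 2
  ext S
  simp only [Finset.mem_filter, Finset.mem_univ, true_and, Finset.mem_insert,
    Finset.mem_singleton]
  tauto

theorem shapleyCoeff_eq_of_mem {d s : ℕ} (hs : 0 < s) (hsd : s < d) :
    shapleyCoeff d (s - 1) = (d : ℝ) / (d - 1) *
      ((((d : ℝ) - 1) / ((d.choose s : ℝ) * s * (d - s))) * (1 - s / d)) := by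
  obtain ⟨s, rfl⟩ : ∃ t, s = t + 1 := ⟨s - 1, by omega⟩
  obtain ⟨r, rfl⟩ : ∃ r, d = s + 1 + (r + 1) := ⟨d - s - 2, by omega⟩
  have e : s + 1 + (r + 1) - (s + 1 - 1) - 1 = r + 1 := by omega
  rw [shapleyCoeff, e, Nat.add_sub_cancel, Nat.cast_choose ℝ (by omega : s + 1 ≤ s + 1 + (r + 1)),
    Nat.add_sub_cancel_left, Nat.factorial_succ s, Nat.factorial_succ r]
  have h1 := Nat.factorial_ne_zero s
  have h2 := Nat.factorial_ne_zero r
  have h3 := Nat.factorial_ne_zero (s + 1 + (r + 1))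
  push_cast
  have h4 : ((s : ℝ) + 1 + (r + 1) - 1) ≠ 0 := by
    have : (0 : ℝ) ≤ s := s.cast_nonneg
    have : (0 : ℝ) ≤ r := r.cast_nonneg
    linarith
  field_simp

theorem shapleyCoeff_eq_of_notMem {d s : ℕ} (hs : 0 < s) (hsd : s < d) :
    -shapleyCoeff d s = (d : ℝ) / (d - 1) *
      ((((d : ℝ) - 1) / ((d.choose s : ℝ) * s * (d - s))) * (0 - s / d)) := by
  obtain ⟨s, rfl⟩ : ∃ t, s = t + 1 := ⟨s - 1, by omega⟩
  obtain ⟨r, rfl⟩ : ∃ r, d = s + 1 + (r + 1) := ⟨d - s - 2, by omega⟩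
  have e : s + 1 + (r + 1) - (s + 1) - 1 = r := by omega
  rw [shapleyCoeff, e, Nat.cast_choose ℝ (by omega : s + 1 ≤ s + 1 + (r + 1)),
    Nat.add_sub_cancel_left, Nat.factorial_succ s, Nat.factorial_succ r]
  have h1 := Nat.factorial_ne_zero s
  have h2 := Nat.factorial_ne_zero r
  have h3 := Nat.factorial_ne_zero (s + 1 + (r + 1))
  push_cast
  have h4 : ((s : ℝ) + 1 + (r + 1) - 1) ≠ 0 := by
    have : (0 : ℝ) ≤ s := s.cast_nonneg
    have : (0 : ℝ) ≤ r := r.cast_nonneg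
    linarith
  have h5 : ((s : ℝ) + 1 + (r + 1) - (s + 1)) = r + 1 := by ring
  rw [h5]
  field_simp
  ring

theorem Coalition.card_pos {d : ℕ} (S : Coalition d) : 0 < S.1.card :=
  Finset.card_pos.2 (Finset.nonempty_iff_ne_empty.2 S.2.1)

theorem Coalition.card_lt {d : ℕ} (S : Coalition d) : S.1.card < d := by
  simpa using Finset.card_lt_card (Finset.ssubset_univ_iff.2 S.2.2)

theorem kernelWeight_nonneg {d : ℕ} (S : Coalition d) : 0 ≤ kernelWeight S := by
  have h1 : ((S.1.card : ℕ) : ℝ) + 1 ≤ d := by exact_mod_cast S.card_lt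
  have h2 : (0 : ℝ) ≤ S.1.card := Nat.cast_nonneg _
  exact div_nonneg (by linarith) (mul_nonneg (by positivity) (by linarith))

theorem shapley_eq_sum_coalition {d : ℕ} (hd : 2 ≤ d) (v : Finset (Fin d) → ℝ) (j : Fin d) :
    shapley v j = (d : ℝ) / (d - 1) * ∑ S : Coalition d,
      kernelWeight S * ((if j ∈ S.1 then 1 else 0) - (S.1.card : ℝ) / d) * (v S.1 - v ∅) +
        meanValue v := by
  rw [shapley_eq_sum_univ, sum_eq_sum_coalition hd]
  have hu : shapleyCoeff d (d - 1) = 1 / d := by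
    obtain ⟨d, rfl⟩ : ∃ e, d = e + 1 := ⟨d - 1, by omega⟩
    have := Nat.factorial_ne_zero d
    simp only [shapleyCoeff, Nat.add_sub_cancel, Nat.factorial_succ]
    simp
    field_simp
  simp only [Finset.notMem_empty, if_false, sub_self, mul_zero, zero_add, Finset.mem_univ, if_true,
    Finset.card_univ, Fintype.card_fin, hu, meanValue]
  rw [add_comm, Finset.mul_sum]
  congr 1
  · refine Finset.sum_congr rfl fun S _ => ?_
    by_cases h : j ∈ S.1
    · simp only [h, if_true, shapleyCoeff_eq_of_mem S.card_pos S.card_lt, kernelWeight]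
      ring
    · simp only [h, if_false, shapleyCoeff_eq_of_notMem S.card_pos S.card_lt, kernelWeight]
      ring
  · ring

/-- Every marginal contribution of j equals `x j`, and the Shapley coefficients sum to 1: each of
the d possible sizes contributes 1/d. -/
theorem shapley_additive {d : ℕ} (hd : 2 ≤ d) (x : Fin d → ℝ) :
    shapley (fun S => ∑ i ∈ S, x i) = x := by
  ext j
  have h1 : shapley (fun S => ∑ i ∈ S, x i) j =
      (∑ S ∈ (Finset.univ.erase j).powerset, shapleyCoeff d S.card) * x j := by
    rw [shapley, Finset.sum_mul]
    refine Finset.sum_congr rfl fun S hS => ?_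
    have : j ∉ S := fun h => by simpa using Finset.mem_powerset.1 hS h
    rw [Finset.sum_insert this, add_sub_cancel_right]
    rfl
  have h2 : ∑ S ∈ (Finset.univ.erase j).powerset, shapleyCoeff d S.card = 1 := by
    rw [Finset.sum_powerset_apply_card, Finset.card_erase_of_mem (Finset.mem_univ j),
      Finset.card_univ, Fintype.card_fin]
    obtain ⟨d, rfl⟩ : ∃ e, d = e + 1 := ⟨d - 1, by omega⟩
    rw [Nat.add_sub_cancel]
    have : ∀ s ∈ Finset.range (d + 1), d.choose s • shapleyCoeff (d + 1) s = 1 / (d + 1) := by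
      intro s hs
      have hs : s ≤ d := by simpa [Nat.lt_succ_iff] using hs
      have e : d + 1 - s - 1 = d - s := by omega
      rw [shapleyCoeff, e, nsmul_eq_mul, Nat.factorial_succ, Nat.cast_choose ℝ hs]
      have h1 := Nat.factorial_ne_zero s
      have h2 := Nat.factorial_ne_zero (d - s)
      have h3 := Nat.factorial_ne_zero d
      push_cast
      field_simp
    rw [Finset.sum_congr rfl this]
    simp
    field_simp
  rw [h1, h2, one_mul]

/-- Appending the unit vector 1/√d to the columns of Q gives a square matrix with orthonormal
columns, whose rows are then orthonormal too. -/
theorem IsOnesComplBasis.mul_transpose {d : ℕ} (hd : 2 ≤ d) {Q : Matrix (Fin d) (Fin (d - 1)) ℝ}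
    (hQ : IsOnesComplBasis Q) : Q * Qᵀ = 1 - (1 / d : ℝ) • Matrix.of fun _ _ => (1 : ℝ) := by
  have hd0 : (0 : ℝ) < d := by positivity
  set c : ℝ := 1 / Real.sqrt d with hc
  have hcc : c * c = 1 / d := by
    rw [hc, div_mul_div_comm, Real.mul_self_sqrt hd0.le, one_mul]
  set o : Matrix (Fin d) Unit ℝ := Matrix.of fun _ _ => c with ho
  have h1 : (fromCols Q o)ᵀ * fromCols Q o = 1 := by
    have hQo : Qᵀ * o = 0 := by
      ext i j
      have := congrFun hQ.2 i
      simp only [mulVec, dotProduct, mul_one, Pi.zero_apply, transpose_apply] at this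
      simp only [ho, Matrix.mul_apply, transpose_apply, of_apply, ← Finset.sum_mul, this, zero_mul,
        Matrix.zero_apply]
    have hoQ : oᵀ * Q = 0 := by rw [← transpose_transpose Q, ← transpose_mul, hQo, transpose_zero]
    have hoo : oᵀ * o = 1 := by
      ext i j
      simp [ho, Matrix.mul_apply, hcc, hd0.ne']
    rw [transpose_fromCols, fromRows_mul_fromCols, hQ.1, hQo, hoQ, hoo, fromBlocks_one]
  have e : Fin d ≃ Fin (d - 1) ⊕ Unit := Fintype.equivOfCardEq (by simp; omega)
  have h2 := (mul_eq_one_comm_of_equiv e.symm).1 h1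
  rw [transpose_fromCols, fromCols_mul_fromRows] at h2
  rw [← h2]
  ext i j
  simp [ho, Matrix.mul_apply, hcc]

theorem matZ'_apply {d : ℕ} (S : Coalition d) (j : Fin d) :
    matZ' d S j = Real.sqrt (kernelWeight S) * if j ∈ S.1 then 1 else 0 := by
  simp [matZ', sqrtW, matZ]

theorem vecB_apply {d : ℕ} (v : Finset (Fin d) → ℝ) (S : Coalition d) :
    vecB v S = Real.sqrt (kernelWeight S) * (v S.1 - v ∅) := by
  simp [vecB, sqrtW, mulVec_diagonal]

theorem shapley_eq_mulVec_vecB {d : ℕ} (hd : 2 ≤ d) {Q : Matrix (Fin d) (Fin (d - 1)) ℝ}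
    (hQ : IsOnesComplBasis Q) (v : Finset (Fin d) → ℝ) :
    shapley v = ((d : ℝ) / (d - 1)) • (Q *ᵥ Qᵀ *ᵥ (matZ' d)ᵀ *ᵥ vecB v) +
      fun _ => meanValue v := by
  ext j
  rw [shapley_eq_sum_coalition hd, mulVec_mulVec, hQ.mul_transpose hd]
  simp only [Pi.add_apply, Pi.smul_apply, smul_eq_mul, sub_mulVec, one_mulVec, Pi.sub_apply,
    smul_mulVec]
  congr 2
  have h1 : ∀ i, ((matZ' d)ᵀ *ᵥ vecB v) i =
      ∑ S : Coalition d, kernelWeight S * (if i ∈ S.1 then 1 else 0) * (v S.1 - v ∅) := by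
    intro i
    simp only [mulVec, dotProduct, transpose_apply, matZ'_apply, vecB_apply]
    refine Finset.sum_congr rfl fun S _ => ?_
    linear_combination ((if i ∈ S.1 then 1 else 0) * (v S.1 - v ∅)) *
      Real.mul_self_sqrt (kernelWeight_nonneg S)
  have h2 : ((Matrix.of fun _ _ => (1 : ℝ)) *ᵥ (matZ' d)ᵀ *ᵥ vecB v) j =
      ∑ S : Coalition d, kernelWeight S * S.1.card * (v S.1 - v ∅) := by
    rw [mulVec, dotProduct]
    simp only [of_apply, one_mul, h1]
    rw [Finset.sum_comm]
    refine Finset.sum_congr rfl fun S _ => ?_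
    rw [← Finset.sum_mul, ← Finset.mul_sum]
    simp
  rw [h1, h2, Finset.mul_sum, ← Finset.sum_sub_distrib]
  exact Finset.sum_congr rfl fun S _ => by ring

theorem vecB_additive {d : ℕ} (x : Fin d → ℝ) :
    vecB (fun S => ∑ i ∈ S, x i) = matZ' d *ᵥ x := by
  ext S
  rw [vecB_apply, mulVec, dotProduct]
  simp only [matZ'_apply, mul_assoc, ← Finset.mul_sum]
  simp

/-- The additive game with weights x has Shapley values x and `vecB` equal to Z'x. Taking x in the
range of Q yields UᵀU = 1; taking x = 1 shows that the λ term does not affect φ*. -/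
theorem eq_mulVec_matZ' {d : ℕ} (hd : 2 ≤ d) {Q : Matrix (Fin d) (Fin (d - 1)) ℝ}
    (hQ : IsOnesComplBasis Q) (x : Fin d → ℝ) :
    x = ((d : ℝ) / (d - 1)) • (Q *ᵥ Qᵀ *ᵥ (matZ' d)ᵀ *ᵥ matZ' d *ᵥ x) +
      fun _ => (∑ i, x i) / d := by
  have := shapley_eq_mulVec_vecB hd hQ fun S => ∑ i ∈ S, x i
  rw [shapley_additive hd, vecB_additive] at this
  simpa [meanValue] using this

theorem sqrt_mul_sqrt_ratio {d : ℕ} (hd : 2 ≤ d) :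
    Real.sqrt ((d : ℝ) / (d - 1)) * Real.sqrt ((d : ℝ) / (d - 1)) = (d : ℝ) / (d - 1) := by
  have : (2 : ℝ) ≤ d := by exact_mod_cast hd
  exact Real.mul_self_sqrt (div_nonneg (by linarith) (by linarith))

/-- The columns of `U` are orthonormal. -/
theorem matU_transpose_mul_self {d : ℕ} (hd : 2 ≤ d) {Q : Matrix (Fin d) (Fin (d - 1)) ℝ}
    (hQ : IsOnesComplBasis Q) : (matU Q)ᵀ * matU Q = 1 := by
  refine ext_of_mulVec_single fun i => ?_
  generalize (Pi.single i 1 : Fin (d - 1) → ℝ) = y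
  -- The columns of Q are orthogonal to 1, so the mean term of `eq_mulVec_matZ'` vanishes.
  have hsum : ∑ i, (Q *ᵥ y) i = 0 := by
    have : (fun _ => (1 : ℝ)) ⬝ᵥ Q *ᵥ y = 0 := by
      rw [dotProduct_mulVec, ← mulVec_transpose, hQ.2, zero_dotProduct]
    simpa [dotProduct] using this
  have h := congrArg (fun z => Qᵀ *ᵥ z) (eq_mulVec_matZ' hd hQ (Q *ᵥ y))
  simp only [hsum, zero_div, mulVec_add, mulVec_smul, mulVec_mulVec, hQ.1, one_mulVec] at h
  have h0 : Qᵀ *ᵥ (fun _ => (0 : ℝ)) = 0 := mulVec_zero _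
  rw [h0, add_zero] at h
  rw [one_mulVec, matU, transpose_smul, Matrix.smul_mul, Matrix.mul_smul, smul_smul,
    sqrt_mul_sqrt_ratio hd, smul_mulVec,
    transpose_mul]
  conv_rhs => rw [h]
  simp only [← Matrix.mul_assoc, hQ.1, Matrix.one_mul]

theorem shapley_eq_mulVec_vecBLam {d : ℕ} (hd : 2 ≤ d) {Q : Matrix (Fin d) (Fin (d - 1)) ℝ}
    (hQ : IsOnesComplBasis Q) (v : Finset (Fin d) → ℝ) (lam : ℝ) :
    shapley v = Q *ᵥ (matU Q)ᵀ *ᵥ vecBLam v lam + fun _ => meanValue v := by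
  have hd' : (2 : ℝ) ≤ d := by exact_mod_cast hd
  have h1 : ((d : ℝ) / (d - 1)) • (Q *ᵥ Qᵀ *ᵥ (matZ' d)ᵀ *ᵥ matZ' d *ᵥ fun _ => (1 : ℝ)) = 0 := by
    have := eq_mulVec_matZ' hd hQ fun _ => 1
    have h2 : (∑ _i : Fin d, (1 : ℝ)) / d = 1 := by
      simp; omega
    rw [h2] at this
    exact add_eq_right.1 this.symm
  rw [shapley_eq_mulVec_vecB hd hQ, matU, vecBLam, transpose_smul, transpose_mul, smul_mulVec,
    mulVec_smul, mulVec_smul, mulVec_smul, smul_smul, sqrt_mul_sqrt_ratio hd, mulVec_sub, mulVec_smul,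
    ← mulVec_mulVec, ← mulVec_mulVec, mulVec_sub, mulVec_smul, smul_sub, smul_comm _ lam, h1,
    smul_zero, sub_zero]

/-! ### Deterministic error bounds for a sketch with diagonal Gram matrix -/

theorem euclNorm_sq {ι : Type*} [Fintype ι] (x : ι → ℝ) : euclNorm x ^ 2 = x ⬝ᵥ x :=
  norm_toLp_sq x

theorem euclNorm_nonneg {ι : Type*} [Fintype ι] (x : ι → ℝ) : 0 ≤ euclNorm x := norm_nonneg _

theorem euclNorm_neg {ι : Type*} [Fintype ι] (x : ι → ℝ) : euclNorm (-x) = euclNorm x := by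
  rw [euclNorm, WithLp.toLp_neg, norm_neg, euclNorm]

theorem dotProduct_le_euclNorm_mul {ι : Type*} [Fintype ι] (x y : ι → ℝ) :
    x ⬝ᵥ y ≤ euclNorm x * euclNorm y := by
  have := real_inner_le_norm (WithLp.toLp 2 x) (WithLp.toLp 2 y)
  rwa [inner_eq_dotProduct] at this

theorem mulVec_dotProduct_eq {σ n : Type*} [Fintype σ] [Fintype n] (U : Matrix σ n ℝ) (x : n → ℝ)
    (y : σ → ℝ) : (U *ᵥ x) ⬝ᵥ y = x ⬝ᵥ Uᵀ *ᵥ y := by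
  rw [mulVec_transpose, dotProduct_comm, dotProduct_mulVec, dotProduct_comm]

theorem euclNorm_mulVec_of_transpose_mul_self {σ n : Type*} [Fintype σ] [Fintype n] [DecidableEq n]
    {Q : Matrix σ n ℝ} (hQ : Qᵀ * Q = 1) (y : n → ℝ) : euclNorm (Q *ᵥ y) = euclNorm y := by
  rw [← sq_eq_sq₀ (euclNorm_nonneg _) (euclNorm_nonneg _), euclNorm_sq, euclNorm_sq,
    mulVec_dotProduct_eq, mulVec_mulVec, hQ, one_mulVec]

theorem euclNorm_mulVec_sq {ρ σ : Type*} [Fintype ρ] [Fintype σ] [DecidableEq σ]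
    {A : Matrix ρ σ ℝ} {D : σ → ℝ} (hA : Aᵀ * A = diagonal D) (z : σ → ℝ) :
    euclNorm (A *ᵥ z) ^ 2 = ∑ S, D S * z S ^ 2 := by
  rw [euclNorm_sq, mulVec_dotProduct_eq, mulVec_mulVec, hA, dotProduct]
  exact Finset.sum_congr rfl fun S _ => by rw [mulVec_diagonal]; ring

theorem matVecAccurate_of_euclNorm_lt {d : ℕ} (hd : 2 ≤ d) {Q : Matrix (Fin d) (Fin (d - 1)) ℝ}
    (hQ : IsOnesComplBasis Q) (v : Finset (Fin d) → ℝ) (lam ε : ℝ) {ρ : Type*} [Fintype ρ]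
    {A : Matrix ρ (Coalition d) ℝ} {D : Coalition d → ℝ} (hA : Aᵀ * A = diagonal D)
    (h : euclNorm ((matU Q)ᵀ *ᵥ fun S => (D S - 1) * vecBLam v lam S) < ε) :
    MatVecAccurate Q v lam ε A := by
  have e : shapley v - matVecEstimate Q v lam A =
      Q *ᵥ (-((matU Q)ᵀ *ᵥ fun S => (D S - 1) * vecBLam v lam S)) := by
    have e2 : (fun S => (D S - 1) * vecBLam v lam S) =
        diagonal D *ᵥ vecBLam v lam - vecBLam v lam := by
      ext S; rw [Pi.sub_apply, mulVec_diagonal]; ring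
    rw [shapley_eq_mulVec_vecBLam hd hQ v lam, matVecEstimate, Matrix.mul_assoc _ Aᵀ, hA, e2,
      mulVec_sub, neg_sub, mulVec_sub, add_sub_add_right_eq_sub]
    simp only [mulVec_mulVec, Matrix.mul_assoc]
  rw [MatVecAccurate, e, euclNorm_mulVec_of_transpose_mul_self hQ.1, euclNorm_neg]
  exact h

/-- With t = x - Uᵀb and r = P_U b, minimality against Uᵀb gives tᵀUᵀDUt ≤ 2 t·UᵀDr, and Uᵀr = 0
turns the right side into 2 t·Uᵀ(D - I)r. Then `hq` and Cauchy-Schwarz give ‖t‖²/4 ≤ 2‖t‖‖Uᵀ(D -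
I)r‖, whence the ε/8. -/
theorem regressionAccurate_of_euclNorm_lt {d : ℕ} (hd : 2 ≤ d)
    {Q : Matrix (Fin d) (Fin (d - 1)) ℝ}
    (hQ : IsOnesComplBasis Q) (v : Finset (Fin d) → ℝ) (lam ε : ℝ) {ρ : Type*} [Fintype ρ]
    {A : Matrix ρ (Coalition d) ℝ} {D : Coalition d → ℝ} (hA : Aᵀ * A = diagonal D)
    (hq : ∀ x, 1 / 4 * (x ⬝ᵥ x) ≤ ∑ S, D S * (matU Q *ᵥ x) S ^ 2)
    (h : euclNorm ((matU Q)ᵀ *ᵥ fun S => (D S - 1) * (projCompl Q *ᵥ vecBLam v lam) S) < ε / 8) :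
    RegressionAccurate Q v lam ε A := by
  set U := matU Q with hU
  set b := vecBLam v lam with hb
  have hUU : Uᵀ * U = 1 := matU_transpose_mul_self hd hQ
  have adj : ∀ (x : Fin (d - 1) → ℝ) (z : Coalition d → ℝ),
      ∑ S, D S * (U *ᵥ x) S * z S = x ⬝ᵥ Uᵀ *ᵥ fun S => D S * z S := by
    intro x z
    rw [← mulVec_dotProduct_eq, dotProduct]
    exact Finset.sum_congr rfl fun _ _ => by ring
  have expand : ∀ z z' : Coalition d → ℝ, ∑ S, D S * (z + z') S ^ 2 =
      ∑ S, D S * z S ^ 2 + 2 * ∑ S, D S * z S * z' S + ∑ S, D S * z' S ^ 2 := by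
    intro z z'
    rw [Finset.mul_sum, ← Finset.sum_add_distrib, ← Finset.sum_add_distrib]
    exact Finset.sum_congr rfl fun _ _ => by rw [Pi.add_apply]; ring
  constructor
  · set M := Uᵀ * diagonal D * U with hM
    have hMx : ∀ x, M *ᵥ x = Uᵀ *ᵥ fun S => D S * (U *ᵥ x) S := by
      intro x
      rw [hM, ← mulVec_mulVec, ← mulVec_mulVec]
      congr 1; ext S; rw [mulVec_diagonal]
    -- `hq` makes UᵀDU invertible, so the normal equations have a solution; expanding around it
    -- shows that it is a minimizer.
    have hinj : Function.Injective M.mulVec := by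
      intro x y hxy
      have h0 : M *ᵥ (x - y) = 0 := by
        rw [mulVec_sub, sub_eq_zero]; exact hxy
      have h1 : ∑ S, D S * (U *ᵥ (x - y)) S ^ 2 = 0 := by
        have := adj (x - y) (U *ᵥ (x - y))
        rw [← hMx, h0, dotProduct_zero] at this
        rw [← this]; exact Finset.sum_congr rfl fun _ _ => by ring
      have h2 : (x - y) ⬝ᵥ (x - y) = 0 := by
        refine le_antisymm ?_ (by rw [← euclNorm_sq]; positivity)
        have := hq (x - y)
        linarith
      exact sub_eq_zero.1 (dotProduct_self_eq_zero.1 h2)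
    obtain ⟨x, hx⟩ := (mulVec_surjective_iff_isUnit.2 (mulVec_injective_iff_isUnit.1 hinj))
      (Uᵀ *ᵥ fun S => D S * b S)
    refine ⟨_, x, fun y => ?_, rfl⟩
    rw [euclNorm_mulVec_sq hA, euclNorm_mulVec_sq hA]
    have e : U *ᵥ y - b = U *ᵥ (y - x) + (U *ᵥ x - b) := by rw [mulVec_sub]; abel
    have hz : ∑ S, D S * (U *ᵥ (y - x)) S * (U *ᵥ x - b) S = 0 := by
      rw [adj]
      have : (fun S => D S * (U *ᵥ x - b) S) =
          (fun S => D S * (U *ᵥ x) S) - fun S => D S * b S := by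
        ext S; simp only [Pi.sub_apply]; ring
      rw [this, mulVec_sub, ← hMx]
      have hx' : M *ᵥ x = Uᵀ *ᵥ fun S => D S * b S := hx
      rw [hx', sub_self, dotProduct_zero]
    have h1 := hq (y - x)
    have h2 : 0 ≤ (y - x) ⬝ᵥ (y - x) := by rw [← euclNorm_sq]; positivity
    rw [e, expand, hz]
    linarith
  · rintro φ ⟨x, hx, rfl⟩
    set t := x - Uᵀ *ᵥ b with ht
    have hr : projCompl Q *ᵥ b = b - U *ᵥ Uᵀ *ᵥ b := by
      rw [projCompl, sub_mulVec, one_mulVec, mulVec_mulVec]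
    set r := projCompl Q *ᵥ b with hrdef
    have hUr : Uᵀ *ᵥ r = 0 := by
      rw [hr, mulVec_sub, mulVec_mulVec, hUU, one_mulVec, sub_self]
    have h1 := hx (Uᵀ *ᵥ b)
    rw [euclNorm_mulVec_sq hA, euclNorm_mulVec_sq hA] at h1
    have e1 : U *ᵥ x - b = U *ᵥ t + (-r) := by rw [ht, mulVec_sub, hr]; abel
    have e2 : U *ᵥ Uᵀ *ᵥ b - b = -r := by rw [hr]; abel
    rw [e1, e2, expand, adj] at h1
    have e3 : (fun S => D S * (-r) S) = -(fun S => (D S - 1) * r S) - r := by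
      ext S; simp only [Pi.sub_apply, Pi.neg_apply]; ring
    have e4 : Uᵀ *ᵥ (-(fun S => (D S - 1) * r S) - r) = -(Uᵀ *ᵥ fun S => (D S - 1) * r S) := by
      rw [mulVec_sub, hUr, sub_zero, mulVec_neg]
    rw [e3, e4, dotProduct_neg] at h1
    have h2 := hq t
    have h3 := dotProduct_le_euclNorm_mul t (Uᵀ *ᵥ fun S => (D S - 1) * r S)
    rw [← euclNorm_sq] at h2
    have h4 : euclNorm t < ε := by
      have h5 := euclNorm_nonneg t
      have h7 := euclNorm_nonneg (Uᵀ *ᵥ fun S => (D S - 1) * r S)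
      by_contra! h6
      have h8 := mul_lt_mul_of_pos_left h (by linarith : 0 < euclNorm t)
      have h9 := mul_le_mul_of_nonneg_left h6 h5
      nlinarith
    have e : shapley v - (Q *ᵥ x + fun _ => meanValue v) = Q *ᵥ (-t) := by
      rw [shapley_eq_mulVec_vecBLam hd hQ v lam, add_sub_add_right_eq_sub, ← mulVec_sub, ht,
        neg_sub]
    rw [e, euclNorm_mulVec_of_transpose_mul_self hQ.1, euclNorm_neg]
    exact h4

/-! ### Rows of U, the parameters η and γ, and the passage from moments to probabilities -/

theorem sum_vecMulVec_rows {σ n : Type*} [Fintype σ] (U : Matrix σ n ℝ) :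
    ∑ S, vecMulVec (U S) (U S) = Uᵀ * U := by
  ext i j
  simp [Matrix.sum_apply, vecMulVec_apply, Matrix.mul_apply]

theorem selfOuter_sqrt_smul {n : Type*} {t : ℝ} (ht : 0 ≤ t) (u : n → ℝ) :
    selfOuter (Real.sqrt t • u) = t • selfOuter u := by
  ext i j
  simp only [coe_selfOuter, selfAdjoint.val_smul, vecMulVec_apply, Matrix.smul_apply,
    Pi.smul_apply, smul_eq_mul]
  linear_combination u i * u j * Real.mul_self_sqrt ht

theorem le_etaParam {d : ℕ} (Q : Matrix (Fin d) (Fin (d - 1)) ℝ) (p : Coalition d → ℝ)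
    (S : Coalition d) : (matU Q S ⬝ᵥ matU Q S) / p S ≤ etaParam Q p := by
  rw [← euclNorm_sq]
  exact le_ciSup (f := fun S => euclNorm (matU Q S) ^ 2 / p S) (Set.finite_range _).bddAbove S

theorem gammaParam_eq {d : ℕ} (Q : Matrix (Fin d) (Fin (d - 1)) ℝ) (p z : Coalition d → ℝ) :
    gammaParam Q p z = ∑ S, (matU Q S ⬝ᵥ matU Q S) / p S * z S ^ 2 := by
  simp only [gammaParam, euclNorm_sq]

theorem gammaParam_nonneg {d : ℕ} (Q : Matrix (Fin d) (Fin (d - 1)) ℝ) {p : Coalition d → ℝ}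
    (hp : IsSamplingDistribution p) (z : Coalition d → ℝ) : 0 ≤ gammaParam Q p z :=
  Finset.sum_nonneg fun S _ => mul_nonneg (div_nonneg (sq_nonneg _) (hp.1 S).le) (sq_nonneg _)

theorem etaParam_pos {d : ℕ} (hd : 2 ≤ d) {Q : Matrix (Fin d) (Fin (d - 1)) ℝ}
    (hQ : IsOnesComplBasis Q) {p : Coalition d → ℝ} (hp : IsSamplingDistribution p) :
    0 < etaParam Q p := by
  by_contra! h
  have h0 : ∀ S, matU Q S = 0 := by
    intro S
    have h1 := (le_etaParam Q p S).trans h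
    rw [div_le_iff₀ (hp.1 S), zero_mul, ← euclNorm_sq] at h1
    exact dotProduct_self_eq_zero.1 (by rw [← euclNorm_sq]; exact le_antisymm h1 (sq_nonneg _))
  have h1 := matU_transpose_mul_self hd hQ
  have h2 : matU Q = 0 := by ext S j; rw [h0 S]; rfl
  have := congrFun (congrFun h1 ⟨0, by omega⟩) ⟨0, by omega⟩
  simp [h2] at this

/-- The bound on `m` for the regression estimator suffices as soon as the second moment of the
sketching error and the exponential moment of the sketched Gram matrix are controlled. -/
theorem one_sub_lt_measureReal_regression {d : ℕ} (hd : 2 ≤ d)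
    {Q : Matrix (Fin d) (Fin (d - 1)) ℝ} {ε δ γ m θ : ℝ} (hε : 0 < ε) (hδ : 0 < δ)
    (hδ1 : δ < 1) (hm : 0 < m) (hθ : θ = 8 * Real.log (d / δ))
    (hγ : 256 * (γ / (δ * ε ^ 2)) ≤ m)
    {J K Ω : Type*} [Fintype J] [DecidableEq J] [Fintype K] [MeasurableSpace K]
    [MeasurableSingletonClass K] [MeasurableSpace Ω] (μ : Measure Ω) [IsProbabilityMeasure μ]
    (Y : J → Ω → K) (hY : ∀ j, Measurable (Y j)) (hi : iIndepFun Y μ) (w : J → K → ℝ)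
    (hw : ∀ j k, μ.real {ω | Y j ω = k} = w j k)
    (D : (J → K) → Coalition d → ℝ)
    (T : (J → K) → selfAdjoint (Matrix (Fin (d - 1)) (Fin (d - 1)) ℝ))
    (hT : ∀ f x, x ⬝ᵥ (T f : Matrix _ _ ℝ) *ᵥ x = θ * ∑ S, D f S * (matU Q *ᵥ x) S ^ 2)
    (hTw : ∑ f : J → K, (∏ j, w j (f j)) * expTrace (T f) ≤ ((d : ℝ) - 1) * Real.exp (-(θ / 2)))
    (g : (J → K) → Fin (d - 1) → ℝ)
    (hg : ∑ f : J → K, (∏ j, w j (f j)) * (g f ⬝ᵥ g f) ≤ γ / m)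
    (G : (J → K) → Prop)
    (hG : ∀ f, (∀ x, 1 / 4 * (x ⬝ᵥ x) ≤ ∑ S, D f S * (matU Q *ᵥ x) S ^ 2) →
      euclNorm (g f) < ε / 8 → G f) :
    1 - δ < μ.real {ω | G fun j => Y j ω} := by
  have hd' : (2 : ℝ) ≤ d := by exact_mod_cast hd
  have hlog : 0 < Real.log (d / δ) := Real.log_pos (by rw [one_lt_div hδ]; linarith)
  refine one_sub_lt_measureReal_of_sum_lt μ Y hY hi w hw G
    -- Each failure makes one summand at least 1: ‖g‖ ≥ ε/8 the first, a form value below 1/4 the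
    -- second. One Markov bound covers both.
    (fun f => 64 / ε ^ 2 * (g f ⬝ᵥ g f) + Real.exp (θ / 4) * expTrace (T f)) ?_ ?_ ?_
  · intro f
    rw [← euclNorm_sq]
    have := expTrace_nonneg (T f)
    positivity
  · intro f hf
    have h1 : 0 ≤ Real.exp (θ / 4) * expTrace (T f) :=
      mul_nonneg (Real.exp_pos _).le (expTrace_nonneg _)
    have h2 : 0 ≤ 64 / ε ^ 2 * (g f ⬝ᵥ g f) := by rw [← euclNorm_sq]; positivity
    by_cases hx : ∀ x, 1 / 4 * (x ⬝ᵥ x) ≤ ∑ S, D f S * (matU Q *ᵥ x) S ^ 2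
    · have h3 : ε / 8 ≤ euclNorm (g f) := not_lt.1 fun h => hf (hG f hx h)
      have h4 : (ε / 8) ^ 2 ≤ g f ⬝ᵥ g f := by
        rw [← euclNorm_sq]; exact pow_le_pow_left₀ (by positivity) h3 2
      have h5 := mul_le_mul_of_nonneg_left h4 (by positivity : 0 ≤ 64 / ε ^ 2)
      have h6 : 64 / ε ^ 2 * (ε / 8) ^ 2 = 1 := by field_simp; norm_num
      linarith
    · push Not at hx
      obtain ⟨x, hx⟩ := hx
      have h3 : Real.exp (-(θ / 4)) ≤ expTrace (T f) := by
        refine exp_neg_le_expTrace (T f) (θ / 4) x ?_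
        rw [hT]
        have hθ0 : 0 < θ := by rw [hθ]; positivity
        have := mul_lt_mul_of_pos_left hx hθ0
        linarith
      have h4 := mul_le_mul_of_nonneg_left h3 (Real.exp_pos (θ / 4)).le
      rw [← Real.exp_add, add_neg_cancel, Real.exp_zero] at h4
      linarith
  · have e : ∑ f : J → K, (∏ j, w j (f j)) *
        (64 / ε ^ 2 * (g f ⬝ᵥ g f) + Real.exp (θ / 4) * expTrace (T f)) =
        64 / ε ^ 2 * ∑ f : J → K, (∏ j, w j (f j)) * (g f ⬝ᵥ g f) +
        Real.exp (θ / 4) * ∑ f : J → K, (∏ j, w j (f j)) * expTrace (T f) := by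
      rw [Finset.mul_sum, Finset.mul_sum, ← Finset.sum_add_distrib]
      exact Finset.sum_congr rfl fun _ _ => by ring
    rw [e]
    have h1 : 64 / ε ^ 2 * (γ / m) ≤ δ / 4 := by
      rw [← mul_div_assoc, div_le_iff₀ (by positivity)] at hγ
      rw [div_mul_div_comm, div_le_iff₀ (by positivity)]
      linarith
    -- The choice of θ gives exp(-θ/4) = (δ/d)², and 4(d - 1) ≤ d². The two summands together stay
    -- below δ/2, which leaves room for strict inequality.
    have h2 : Real.exp (θ / 4) * (((d : ℝ) - 1) * Real.exp (-(θ / 2))) ≤ δ / 4 := by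
      have e1 : Real.exp (θ / 4) * (((d : ℝ) - 1) * Real.exp (-(θ / 2))) =
          ((d : ℝ) - 1) * (δ / d) ^ 2 := by
        have : Real.exp (θ / 4) * Real.exp (-(θ / 2)) = (δ / d) ^ 2 := by
          rw [← Real.exp_add, show θ / 4 + -(θ / 2) = -Real.log (d / δ) + -Real.log (d / δ) by
            rw [hθ]; ring, Real.exp_add, ← Real.log_inv, inv_div, Real.exp_log (by positivity), sq]
        rw [← this]; ring
      rw [e1, div_pow, ← mul_div_assoc, div_le_iff₀ (by positivity)]
      have h3 : ((d : ℝ) - 1) * 4 ≤ d ^ 2 := by nlinarith [sq_nonneg ((d : ℝ) - 2)]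
      have h4 : δ ^ 2 ≤ δ := by nlinarith
      nlinarith [mul_le_mul h3 h4 (sq_nonneg δ) (sq_nonneg (d : ℝ))]
    have h3 := mul_le_mul_of_nonneg_left hg (by positivity : 0 ≤ 64 / ε ^ 2)
    have h4 := mul_le_mul_of_nonneg_left hTw (Real.exp_pos (θ / 4)).le
    linarith

theorem one_sub_lt_measureReal_matVec {n : Type*} [Fintype n]
    {ε δ γ m : ℝ} (hε : 0 < ε) (hδ : 0 < δ) (hm : 0 < m)
    (hγ : 256 * (γ / (δ * ε ^ 2)) ≤ m)
    {J K Ω : Type*} [Fintype J] [DecidableEq J] [Fintype K] [MeasurableSpace K]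
    [MeasurableSingletonClass K] [MeasurableSpace Ω] (μ : Measure Ω) [IsProbabilityMeasure μ]
    (Y : J → Ω → K) (hY : ∀ j, Measurable (Y j)) (hi : iIndepFun Y μ) (w : J → K → ℝ)
    (hw : ∀ j k, μ.real {ω | Y j ω = k} = w j k)
    (g : (J → K) → n → ℝ)
    (hg : ∑ f : J → K, (∏ j, w j (f j)) * (g f ⬝ᵥ g f) ≤ γ / m)
    (G : (J → K) → Prop) (hG : ∀ f, euclNorm (g f) < ε → G f) :
    1 - δ < μ.real {ω | G fun j => Y j ω} := by
  refine one_sub_lt_measureReal_of_sum_lt μ Y hY hi w hw G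
    (fun f => 1 / ε ^ 2 * (g f ⬝ᵥ g f)) ?_ ?_ ?_
  · intro f
    rw [← euclNorm_sq]
    positivity
  · intro f hf
    have h3 : ε ≤ euclNorm (g f) := not_lt.1 fun h => hf (hG f h)
    rw [← euclNorm_sq, one_div, ← div_eq_inv_mul, one_le_div (by positivity)]
    exact pow_le_pow_left₀ hε.le h3 2
  · have e : ∑ f : J → K, (∏ j, w j (f j)) * (1 / ε ^ 2 * (g f ⬝ᵥ g f)) =
        1 / ε ^ 2 * ∑ f : J → K, (∏ j, w j (f j)) * (g f ⬝ᵥ g f) := by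
      rw [Finset.mul_sum]
      exact Finset.sum_congr rfl fun _ _ => by ring
    rw [e]
    have h1 : 1 / ε ^ 2 * (γ / m) ≤ δ / 256 := by
      rw [← mul_div_assoc, div_le_iff₀ (by positivity)] at hγ
      rw [div_mul_div_comm, div_le_iff₀ (by positivity)]
      linarith
    have h3 := mul_le_mul_of_nonneg_left hg (by positivity : 0 ≤ 1 / ε ^ 2)
    linarith

/-! ### Gram matrices and moment bounds for the two sampling schemes -/

/-- The diagonal of `Aᵀ A` for the sketching matrix `A` of sampling with replacement. -/
def replacementWeights {d m : ℕ} (p : Coalition d → ℝ) (I : Fin m → Coalition d)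
    (S : Coalition d) : ℝ := ∑ j, if I j = S then 1 / ((m : ℝ) * p S) else 0

/-- The diagonal of `Aᵀ A` for the sketching matrix `A` of sampling without replacement. -/
def bernoulliWeights {d : ℕ} (q : Coalition d → ℝ) (Y : Coalition d → Bool)
    (S : Coalition d) : ℝ := if Y S = true then 1 / q S else 0

theorem sketchReplacement_transpose_mul_self {d m : ℕ} {p : Coalition d → ℝ}
    (hp : IsSamplingDistribution p) (I : Fin m → Coalition d) :
    (sketchReplacement p I)ᵀ * sketchReplacement p I = diagonal (replacementWeights p I) := by
  ext S S'
  simp only [Matrix.mul_apply, transpose_apply, sketchReplacement, of_apply]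
  by_cases h : S = S'
  · subst h
    rw [diagonal_apply_eq, replacementWeights]
    refine Finset.sum_congr rfl fun j _ => ?_
    split_ifs
    · rw [div_mul_div_comm, one_mul, Real.mul_self_sqrt
        (mul_nonneg (Nat.cast_nonneg _) (hp.1 S).le)]
    · simp
  · rw [diagonal_apply_ne _ h]
    refine Finset.sum_eq_zero fun j _ => ?_
    by_cases h1 : I j = S
    · simp [h1, h]
    · simp [h1]

theorem sketchBernoulli_transpose_mul_self {d : ℕ} {q : Coalition d → ℝ}
    (hq : ∀ S, 0 < q S) (Y : Coalition d → Bool) :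
    (sketchBernoulli q Y)ᵀ * sketchBernoulli q Y = diagonal (bernoulliWeights q Y) := by
  ext S S'
  simp only [Matrix.mul_apply, transpose_apply, sketchBernoulli, of_apply]
  by_cases h : S = S'
  · subst h
    rw [diagonal_apply_eq, bernoulliWeights]
    have e : ∀ R : {S : Coalition d // Y S = true},
        ((if R.1 = S then 1 / Real.sqrt (q S) else 0) * if R.1 = S then 1 / Real.sqrt (q S) else 0)
          = if R.1 = S then 1 / q S else 0 := by
      intro R
      split_ifs
      · rw [div_mul_div_comm, one_mul, Real.mul_self_sqrt (hq S).le]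
      · simp
    simp only [e]
    split_ifs with hS
    · rw [Finset.sum_eq_single ⟨S, hS⟩]
      · simp
      · intro R _ hR
        rw [if_neg fun h => hR (Subtype.ext h)]
      · simp
    · refine Finset.sum_eq_zero fun R _ => if_neg fun h => hS ?_
      rw [← h]; exact R.2
  · rw [diagonal_apply_ne _ h]
    refine Finset.sum_eq_zero fun R _ => ?_
    by_cases h1 : R.1 = S
    · simp [h1, h]
    · simp [h1]

theorem transpose_mulVec_eq_sum {σ n : Type*} [Fintype σ] (U : Matrix σ n ℝ) (z : σ → ℝ) :
    Uᵀ *ᵥ z = ∑ S, z S • U S := by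
  ext i
  simp [mulVec, dotProduct, Finset.sum_apply, mul_comm]

theorem selfOuter_quadForm {n : Type*} [Fintype n] (u x : n → ℝ) :
    x ⬝ᵥ (selfOuter u : Matrix n n ℝ) *ᵥ x = (u ⬝ᵥ x) ^ 2 := by
  rw [coe_selfOuter, dotProduct_vecMulVec_mulVec, dotProduct_comm x, sq]

section Replacement
variable {d m : ℕ} {Q : Matrix (Fin d) (Fin (d - 1)) ℝ} {p : Coalition d → ℝ}

/-- The vector is a sum of m independent copies of `a S - y`, where `y` is the mean of `a`. The
variance of each is at most its raw second moment γ(z)/m². -/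
theorem replacement_second_moment (hp : IsSamplingDistribution p) (hm : 0 < m)
    (z : Coalition d → ℝ) :
    ∑ I : Fin m → Coalition d, (∏ j, p (I j)) *
      (((matU Q)ᵀ *ᵥ fun S => (replacementWeights p I S - 1) * z S) ⬝ᵥ
        ((matU Q)ᵀ *ᵥ fun S => (replacementWeights p I S - 1) * z S)) ≤ gammaParam Q p z / m := by
  have hm' : (0 : ℝ) < m := by exact_mod_cast hm
  set y := (1 / m : ℝ) • ((matU Q)ᵀ *ᵥ z) with hy
  set a : Coalition d → Fin (d - 1) → ℝ := fun S => (z S / (m * p S)) • matU Q S with ha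
  have hmean : ∑ S, p S • a S = y := by
    rw [hy, transpose_mulVec_eq_sum, Finset.smul_sum]
    refine Finset.sum_congr rfl fun S _ => ?_
    have := (hp.1 S).ne'
    rw [ha, smul_smul, smul_smul]
    congr 1; field_simp
  have key := sum_prod_mul_dotProduct_self_le (J := Fin m) (fun _ => p) (fun _ S => (hp.1 S).le)
    (fun _ => hp.2) (fun _ S => a S - y) (fun _ => gammaParam Q p z / m ^ 2) (fun _ => ?_)
    (fun _ => ?_)
  · rw [Finset.sum_const, Finset.card_univ, Fintype.card_fin, nsmul_eq_mul] at key
    refine le_trans (le_of_eq ?_) (key.trans (le_of_eq ?_))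
    · refine Finset.sum_congr rfl fun I _ => ?_
      have e : ((matU Q)ᵀ *ᵥ fun S => (replacementWeights p I S - 1) * z S) =
          ∑ j, (a (I j) - y) := by
        rw [Finset.sum_sub_distrib, Finset.sum_const, Finset.card_univ, Fintype.card_fin, hy,
          ← Nat.cast_smul_eq_nsmul ℝ, smul_smul, mul_one_div_cancel hm'.ne', one_smul,
          transpose_mulVec_eq_sum, transpose_mulVec_eq_sum]
        simp only [sub_mul, one_mul, sub_smul, Finset.sum_sub_distrib, replacementWeights,
          Finset.sum_mul, Finset.sum_smul]
        congr 1
        rw [Finset.sum_comm]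
        refine Finset.sum_congr rfl fun j _ => ?_
        rw [Finset.sum_eq_single (I j)]
        · rw [if_pos rfl, one_div_mul_eq_div]
        · intro S _ hS
          rw [if_neg hS.symm]; simp
        · simp
      rw [e]
    · field_simp
  · simp only [smul_sub, Finset.sum_sub_distrib, hmean, ← Finset.sum_smul, hp.2, one_smul, sub_self]
  · have e : ∀ S, p S * ((a S - y) ⬝ᵥ (a S - y)) =
        p S * (a S ⬝ᵥ a S) - 2 * ((p S • a S) ⬝ᵥ y) + p S * (y ⬝ᵥ y) := by
      intro S
      simp only [sub_dotProduct, dotProduct_sub, smul_dotProduct, smul_eq_mul,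
        dotProduct_comm y (a S)]
      ring
    simp only [e, Finset.sum_add_distrib, Finset.sum_sub_distrib, ← Finset.mul_sum,
      ← Finset.sum_mul, ← sum_dotProduct, hmean, hp.2]
    have h1 : ∑ S, p S * (a S ⬝ᵥ a S) = gammaParam Q p z / m ^ 2 := by
      rw [gammaParam_eq, Finset.sum_div]
      refine Finset.sum_congr rfl fun S _ => ?_
      have := (hp.1 S).ne'
      rw [ha]
      simp only [smul_dotProduct, dotProduct_smul, smul_eq_mul]
      field_simp
    have h2 : 0 ≤ y ⬝ᵥ y := by rw [← euclNorm_sq]; positivity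
    rw [h1]
    linarith

/-- The sketched Gram matrix `θ Uᵀ Aᵀ A U` for sampling with replacement. -/
def replacementGram (Q : Matrix (Fin d) (Fin (d - 1)) ℝ) (p : Coalition d → ℝ) (θ : ℝ)
    (I : Fin m → Coalition d) : selfAdjoint (Matrix (Fin (d - 1)) (Fin (d - 1)) ℝ) :=
  ∑ j, selfOuter (Real.sqrt (θ / (m * p (I j))) • matU Q (I j))

theorem replacementGram_quadForm (hp : IsSamplingDistribution p) {θ : ℝ} (hθ : 0 ≤ θ)
    (I : Fin m → Coalition d) (x : Fin (d - 1) → ℝ) :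
    x ⬝ᵥ (replacementGram Q p θ I : Matrix _ _ ℝ) *ᵥ x =
      θ * ∑ S, replacementWeights p I S * (matU Q *ᵥ x) S ^ 2 := by
  have h0 : ∀ S, 0 ≤ θ / (m * p S) := fun S =>
    div_nonneg hθ (mul_nonneg (Nat.cast_nonneg _) (hp.1 S).le)
  simp only [replacementGram, selfOuter_sqrt_smul (h0 _), AddSubgroup.val_finsetSum,
    selfAdjoint.val_smul, sum_mulVec, dotProduct_sum, smul_mulVec, dotProduct_smul,
    selfOuter_quadForm, replacementWeights, Finset.sum_mul, Finset.mul_sum, smul_eq_mul]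
  rw [Finset.sum_comm]
  refine Finset.sum_congr rfl fun j _ => ?_
  rw [Finset.sum_eq_single (I j)]
  · rw [if_pos rfl, mulVec]; ring
  · intro S _ hS
    rw [if_neg hS.symm]; simp
  · simp

theorem replacement_expTrace_le (hd : 2 ≤ d) (hQ : IsOnesComplBasis Q)
    (hp : IsSamplingDistribution p) (hm : 0 < m) {θ : ℝ} (hθ : 0 ≤ θ)
    (hη : 3 * (etaParam Q p * θ) ≤ m) :
    ∑ I : Fin m → Coalition d, (∏ j, p (I j)) * expTrace (replacementGram Q p θ I) ≤
      ((d : ℝ) - 1) * Real.exp (-(θ / 2)) := by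
  have hm' : (0 : ℝ) < m := by exact_mod_cast hm
  have h0 : ∀ S, 0 ≤ θ / (m * p S) := fun S => div_nonneg hθ (mul_nonneg hm'.le (hp.1 S).le)
  have key := sum_prod_mul_le_of_step
    (V := selfAdjoint (Matrix (Fin (d - 1)) (Fin (d - 1)) ℝ)) expTrace (Fin m)
    (fun _ => p) (fun _ S => (hp.1 S).le)
    (fun _ S => selfOuter (Real.sqrt (θ / (m * p S)) • matU Q S))
    -- Half the mean of one increment, since E aaᵀ = (θ/m) UᵀU = (θ/m) I; m of these add up to (θ/2)
    -- I.
    (fun _ => (θ / (2 * m)) • 1) (fun _ A => sum_mul_expTrace_add_selfOuter_le p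
      (fun S => (hp.1 S).le) hp.2 _ (fun S _ => ?_) A _ ?_) 0
  · simp only [zero_add] at key
    refine key.trans (le_of_eq ?_)
    rw [expTrace_of_coe_eq_smul_one _ (θ / 2)]
    · rw [Fintype.card_fin, Nat.cast_sub (by omega), Nat.cast_one]
    · rw [Finset.sum_const, Finset.card_univ, Fintype.card_fin, ← Nat.cast_smul_eq_nsmul ℝ,
        smul_smul, selfAdjoint.val_smul, selfAdjoint.val_one]
      congr 1; field_simp
  · have h1 := le_etaParam Q p S
    have hpS := hp.1 S
    rw [smul_dotProduct, dotProduct_smul, smul_smul, Real.mul_self_sqrt (h0 S), smul_eq_mul]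
    have e : θ / (m * p S) * (matU Q S ⬝ᵥ matU Q S) =
        (matU Q S ⬝ᵥ matU Q S) / p S * θ / m := by field_simp
    rw [e, div_le_div_iff₀ hm' (by norm_num)]
    nlinarith [mul_le_mul_of_nonneg_right h1 hθ]
  · have e : ∀ S, p S • vecMulVec (Real.sqrt (θ / (m * p S)) • matU Q S)
        (Real.sqrt (θ / (m * p S)) • matU Q S) = (θ / m) • vecMulVec (matU Q S) (matU Q S) := by
      intro S
      have hpS := (hp.1 S).ne'
      rw [← coe_selfOuter, selfOuter_sqrt_smul (h0 S), selfAdjoint.val_smul, smul_smul,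
        coe_selfOuter]
      congr 1; field_simp
    simp only [e]
    rw [← Finset.smul_sum, sum_vecMulVec_rows, matU_transpose_mul_self hd hQ, smul_smul,
      selfAdjoint.val_smul, selfAdjoint.val_one]
    congr 1; field_simp

end Replacement

section Bernoulli
variable {d : ℕ} {Q : Matrix (Fin d) (Fin (d - 1)) ℝ} {p q : Coalition d → ℝ} {m : ℝ}

/-- The law of a coin flip with heads probability `q`. -/
def coinWeight (q : ℝ) (k : Bool) : ℝ := if k = true then q else 1 - q

theorem coinWeight_nonneg {q : ℝ} (h0 : 0 ≤ q) (h1 : q ≤ 1) (k : Bool) : 0 ≤ coinWeight q k := by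
  rw [coinWeight]; split_ifs <;> linarith

theorem sum_coinWeight (q : ℝ) : ∑ k, coinWeight q k = 1 := by
  simp [coinWeight]

/-- The coin of S has relative variance 1/q - 1. This is at most 1/(m p) by `hqp` when q < 1, and it
is zero when q = 1, where `hqp` says nothing. -/
theorem bernoulli_second_moment (hq0 : ∀ S, 0 < q S) (hq1 : ∀ S, q S ≤ 1)
    (hqp : ∀ S, q S < 1 → m * p S ≤ q S) (hp : IsSamplingDistribution p) (hm : 0 < m)
    (z : Coalition d → ℝ) :
    ∑ Y : Coalition d → Bool, (∏ S, coinWeight (q S) (Y S)) *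
      (((matU Q)ᵀ *ᵥ fun S => (bernoulliWeights q Y S - 1) * z S) ⬝ᵥ
        ((matU Q)ᵀ *ᵥ fun S => (bernoulliWeights q Y S - 1) * z S)) ≤ gammaParam Q p z / m := by
  have key := sum_prod_mul_dotProduct_self_le (J := Coalition d) (fun S => coinWeight (q S))
    (fun S => coinWeight_nonneg (hq0 S).le (hq1 S)) (fun S => sum_coinWeight (q S))
    (fun S k => (((if k = true then 1 / q S else 0) - 1) * z S) • matU Q S)
    (fun S => (matU Q S ⬝ᵥ matU Q S) / p S * z S ^ 2 / m) (fun S => ?_) (fun S => ?_)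
  · rw [← Finset.sum_div, ← gammaParam_eq] at key
    refine le_trans (le_of_eq ?_) key
    simp only [transpose_mulVec_eq_sum, bernoulliWeights]
  · have := (hq0 S).ne'
    simp only [Fintype.sum_bool, coinWeight, smul_smul, ← add_smul]
    convert zero_smul ℝ (matU Q S) using 2
    simp
    field_simp
    ring
  · have h0 := hq0 S
    have hpS := hp.1 S
    simp only [Fintype.sum_bool, coinWeight, smul_dotProduct, dotProduct_smul, smul_eq_mul]
    have hu : 0 ≤ matU Q S ⬝ᵥ matU Q S := by rw [← euclNorm_sq]; positivity
    have e : q S * ((1 / q S - 1) * z S * ((1 / q S - 1) * z S * (matU Q S ⬝ᵥ matU Q S))) +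
        (1 - q S) * ((0 - 1) * z S * ((0 - 1) * z S * (matU Q S ⬝ᵥ matU Q S))) =
        (1 / q S - 1) * ((matU Q S ⬝ᵥ matU Q S) * z S ^ 2) := by
      field_simp; ring
    have e2 : (matU Q S ⬝ᵥ matU Q S) / p S * z S ^ 2 / m =
        1 / (m * p S) * ((matU Q S ⬝ᵥ matU Q S) * z S ^ 2) := by
      field_simp
    simp only [if_true, Bool.false_eq_true, if_false]
    rw [e, e2]
    refine mul_le_mul_of_nonneg_right ?_ (mul_nonneg hu (sq_nonneg _))
    rcases (hq1 S).lt_or_eq with h1 | h1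
    · have := one_div_le_one_div_of_le (by positivity) (hqp S h1)
      linarith
    · rw [h1]; norm_num; positivity

/-- The sketched Gram matrix `θ Uᵀ Aᵀ A U` for sampling without replacement. -/
def bernoulliGram (Q : Matrix (Fin d) (Fin (d - 1)) ℝ) (q : Coalition d → ℝ) (θ : ℝ)
    (Y : Coalition d → Bool) : selfAdjoint (Matrix (Fin (d - 1)) (Fin (d - 1)) ℝ) :=
  ∑ S, selfOuter (Real.sqrt (if Y S = true then θ / q S else 0) • matU Q S)

theorem bernoulliGram_quadForm (hq0 : ∀ S, 0 < q S) {θ : ℝ} (hθ : 0 ≤ θ)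
    (Y : Coalition d → Bool) (x : Fin (d - 1) → ℝ) :
    x ⬝ᵥ (bernoulliGram Q q θ Y : Matrix _ _ ℝ) *ᵥ x =
      θ * ∑ S, bernoulliWeights q Y S * (matU Q *ᵥ x) S ^ 2 := by
  have h0 : ∀ S, 0 ≤ if Y S = true then θ / q S else 0 := fun S => by
    split_ifs
    · exact div_nonneg hθ (hq0 S).le
    · exact le_rfl
  simp only [bernoulliGram, selfOuter_sqrt_smul (h0 _), AddSubgroup.val_finsetSum,
    selfAdjoint.val_smul, sum_mulVec, dotProduct_sum, smul_mulVec, dotProduct_smul,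
    selfOuter_quadForm, bernoulliWeights, Finset.mul_sum, smul_eq_mul]
  refine Finset.sum_congr rfl fun S _ => ?_
  split_ifs
  · rw [mulVec]; ring
  · simp

theorem bernoulli_expTrace_le (hd : 2 ≤ d) (hQ : IsOnesComplBasis Q)
    (hq0 : ∀ S, 0 < q S) (hq1 : ∀ S, q S ≤ 1)
    (hqp : ∀ S, q S < 1 → m * p S ≤ q S) (hp : IsSamplingDistribution p)
    {θ : ℝ} (hθ : 0 ≤ θ) (hη : 3 * (etaParam Q p * θ) ≤ m) :
    ∑ Y : Coalition d → Bool, (∏ S, coinWeight (q S) (Y S)) * expTrace (bernoulliGram Q q θ Y) ≤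
      ((d : ℝ) - 1) * Real.exp (-(θ / 2)) := by
  have h0 : ∀ S, 0 ≤ θ / q S := fun S => div_nonneg hθ (hq0 S).le
  have key := sum_prod_mul_le_of_step
    (V := selfAdjoint (Matrix (Fin (d - 1)) (Fin (d - 1)) ℝ)) expTrace (Coalition d)
    (fun S => coinWeight (q S)) (fun S => coinWeight_nonneg (hq0 S).le (hq1 S))
    (fun S k => selfOuter (Real.sqrt (if k = true then θ / q S else 0) • matU Q S))
    (fun S => (θ / 2) • selfOuter (matU Q S)) (fun S A => ?_) 0
  · simp only [zero_add] at key
    refine key.trans (le_of_eq ?_)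
    rw [expTrace_of_coe_eq_smul_one _ (θ / 2)]
    · rw [Fintype.card_fin, Nat.cast_sub (by omega), Nat.cast_one]
    · simp only [AddSubgroup.val_finsetSum, selfAdjoint.val_smul, coe_selfOuter]
      rw [← Finset.smul_sum, sum_vecMulVec_rows, matU_transpose_mul_self hd hQ]
  -- For q < 1, the bound m p ≤ q makes the increment small enough for the averaged step. For q = 1
  -- the increment may be large but is deterministic, so monotonicity suffices.
  · rcases (hq1 S).lt_or_eq with h1 | h1
    · refine sum_mul_expTrace_add_selfOuter_le _
        (coinWeight_nonneg (hq0 S).le (hq1 S)) (sum_coinWeight _) _ (fun k _ => ?_) A _ ?_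
      · rcases k with _ | _
        · simp
        · have h2 := le_etaParam Q p S
          have hpS := hp.1 S
          have h3 := hqp S h1
          have hu : 0 ≤ matU Q S ⬝ᵥ matU Q S := by rw [← euclNorm_sq]; positivity
          rw [if_pos rfl, smul_dotProduct, dotProduct_smul, smul_smul, Real.mul_self_sqrt (h0 S),
            smul_eq_mul, div_mul_eq_mul_div, div_le_div_iff₀ (hq0 S) (by norm_num)]
          rw [div_le_iff₀ hpS] at h2
          nlinarith [mul_le_mul_of_nonneg_right h2 hθ, mul_le_mul_of_nonneg_right hη hpS.le]
      · have := (hq0 S).ne'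
        simp only [Fintype.sum_bool, coinWeight, if_true, Bool.false_eq_true, if_false,
          ← coe_selfOuter, selfOuter_sqrt_smul (h0 S), selfAdjoint.val_smul, Real.sqrt_zero,
          zero_smul]
        have e : (selfOuter (0 : Fin (d - 1) → ℝ) 
            : Matrix (Fin (d - 1)) (Fin (d - 1)) ℝ) = 0 := by
          rw [coe_selfOuter, zero_vecMulVec]
        rw [e, smul_zero, add_zero, smul_smul, smul_smul]
        congr 1; field_simp
    · have := expTrace_add_selfOuter_le_half A (Real.sqrt θ • matU Q S)
      simp only [Fintype.sum_bool, coinWeight, if_true, Bool.false_eq_true, if_false, h1, sub_self,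
        zero_mul, add_zero, one_mul, div_one]
      refine this.trans (le_of_eq ?_)
      rw [selfOuter_sqrt_smul hθ, smul_smul]
      congr 3; ring

end Bernoulli

end

/-! ### Assembly for both schemes with C = 256 -/

theorem theorem2 :
    ∃ C : ℝ, 0 < C ∧
      ∀ (d : ℕ), 2 ≤ d →
      ∀ (v : Finset (Fin d) → ℝ) (lam : ℝ)
        (Q : Matrix (Fin d) (Fin (d - 1)) ℝ), IsOnesComplBasis Q →
      ∀ p : Coalition d → ℝ, IsSamplingDistribution p →
      ∀ ε δ : ℝ, 0 < ε → 0 < δ → δ < 1 →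
      ∀ (Ω : Type*) [MeasurableSpace Ω] (μ : Measure Ω) [IsProbabilityMeasure μ],
        -- sampling with replacement, `m` samples
        (∀ (m : ℕ) (I : Fin m → Ω → Coalition d), IsReplacementSample μ p I →
          (C * (gammaParam Q p (projCompl Q *ᵥ vecBLam v lam) / (δ * ε ^ 2) +
                etaParam Q p * Real.log ((d : ℝ) / δ)) ≤ (m : ℝ) →
            1 - δ < μ.real {ω | RegressionAccurate Q v lam ε
              (sketchReplacement p fun j => I j ω)}) ∧
          (C * (gammaParam Q p (vecBLam v lam) / (δ * ε ^ 2)) ≤ (m : ℝ) →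
            1 - δ < μ.real {ω | MatVecAccurate Q v lam ε
              (sketchReplacement p fun j => I j ω)})) ∧
        -- sampling without replacement, `m` samples on average
        (∀ (m c : ℝ) (q : Coalition d → ℝ) (Y : Coalition d → Ω → Bool), 0 < c →
          (∀ S, q S = min 1 (c * p S)) → ∑ S, q S = m → IsBernoulliSample μ q Y →
          (C * (gammaParam Q p (projCompl Q *ᵥ vecBLam v lam) / (δ * ε ^ 2) +
                etaParam Q p * Real.log ((d : ℝ) / δ)) ≤ m →
            1 - δ < μ.real {ω | RegressionAccurate Q v lam ε
              (sketchBernoulli q fun S => Y S ω)}) ∧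
          (C * (gammaParam Q p (vecBLam v lam) / (δ * ε ^ 2)) ≤ m →
            1 - δ < μ.real {ω | MatVecAccurate Q v lam ε
              (sketchBernoulli q fun S => Y S ω)})) := by
  refine ⟨256, by norm_num, fun d hd v lam Q hQ p hp ε δ hε hδ hδ1 Ω _ μ _ => ?_⟩
  have hd' : (2 : ℝ) ≤ d := by exact_mod_cast hd
  have hlog : 0 < Real.log (d / δ) := Real.log_pos (by rw [one_lt_div hδ]; linarith)
  have hηpos : 0 < etaParam Q p * Real.log (d / δ) := mul_pos (etaParam_pos hd hQ hp) hlog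
  have hγ0 : ∀ z, 0 ≤ gammaParam Q p z / (δ * ε ^ 2) := fun z =>
    div_nonneg (gammaParam_nonneg Q hp z) (by positivity)
  set θ : ℝ := 8 * Real.log (d / δ) with hθ
  have hθ0 : 0 ≤ θ := by positivity
  constructor
  · intro m I hI
    have : MeasurableSingletonClass (Coalition d) := ⟨fun _ => trivial⟩
    constructor
    · intro hm
      have h1 := hγ0 (projCompl Q *ᵥ vecBLam v lam)
      -- The η log(d/δ) term is strictly positive and excludes an empty sample.
      have hm0 : (0 : ℝ) < m := by linarith
      have hm0' : 0 < m := by exact_mod_cast hm0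
      refine one_sub_lt_measureReal_regression hd hε hδ hδ1 hm0 hθ (by linarith) μ I hI.1 hI.2.1
        (fun _ => p) hI.2.2 (replacementWeights p) (replacementGram Q p θ)
        (replacementGram_quadForm hp hθ0)
        (replacement_expTrace_le hd hQ hp hm0' hθ0 (by rw [hθ]; linarith)) _
        (replacement_second_moment hp hm0' _)
        (fun f => RegressionAccurate Q v lam ε (sketchReplacement p f)) fun f =>
          regressionAccurate_of_euclNorm_lt hd hQ v lam ε
            (sketchReplacement_transpose_mul_self hp f)
    · intro hm
      -- An empty sample is allowed here. It forces γ(b_λ) = 0, so every S has u_S = 0 or a zero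
      -- entry of b_λ, and the estimator is exact.
      rcases Nat.eq_zero_or_pos m with rfl | hm0'
      · have hγ : gammaParam Q p (vecBLam v lam) = 0 := by
          have h1 := hγ0 (vecBLam v lam)
          have h2 : gammaParam Q p (vecBLam v lam) / (δ * ε ^ 2) = 0 := by
            push_cast at hm; linarith
          exact (div_eq_zero_iff.1 h2).resolve_right (by positivity)
        rw [gammaParam_eq, Finset.sum_eq_zero_iff_of_nonneg (fun S _ => mul_nonneg (div_nonneg
          (by rw [← euclNorm_sq]; positivity) (hp.1 S).le) (sq_nonneg _))] at hγ
        have hall : ∀ f : Fin 0 → Coalition d,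
            MatVecAccurate Q v lam ε (sketchReplacement p f) := by
          intro f
          refine matVecAccurate_of_euclNorm_lt hd hQ v lam ε
            (sketchReplacement_transpose_mul_self hp f) ?_
          have e : ((matU Q)ᵀ *ᵥ fun S => (replacementWeights p f S - 1) * vecBLam v lam S) = 0 := by
            rw [transpose_mulVec_eq_sum]
            refine Finset.sum_eq_zero fun S _ => ?_
            rcases mul_eq_zero.1 (hγ S (Finset.mem_univ S)) with h | h
            · rw [dotProduct_self_eq_zero.1 ((div_eq_zero_iff.1 h).resolve_right (hp.1 S).ne'),
                smul_zero]
            · rw [pow_eq_zero_iff two_ne_zero |>.1 h, mul_zero, zero_smul]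
          rw [e, euclNorm, WithLp.toLp_zero, norm_zero]
          exact hε
        simp only [hall, Set.ofPred_true, probReal_univ]
        linarith
      · have hm0 : (0 : ℝ) < m := by exact_mod_cast hm0'
        exact one_sub_lt_measureReal_matVec hε hδ hm0 hm μ I hI.1 hI.2.1 (fun _ => p) hI.2.2 _
          (replacement_second_moment hp hm0' _)
          (fun f => MatVecAccurate Q v lam ε (sketchReplacement p f)) fun f =>
            matVecAccurate_of_euclNorm_lt hd hQ v lam ε (sketchReplacement_transpose_mul_self hp f)
  · intro m c q Y hc hq hqm hY
    have hq0 : ∀ S, 0 < q S := fun S => by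
      rw [hq]; exact lt_min one_pos (mul_pos hc (hp.1 S))
    have hq1 : ∀ S, q S ≤ 1 := fun S => by rw [hq]; exact min_le_left _ _
    -- Truncation at 1 only lowers the expected sample size, so an untruncated q_S = c p_S is at
    -- least m p_S.
    have hmc : m ≤ c := by
      rw [← hqm, ← mul_one c, ← hp.2, Finset.mul_sum]
      exact Finset.sum_le_sum fun S _ => by rw [hq]; exact min_le_right _ _
    have hqp : ∀ S, q S < 1 → m * p S ≤ q S := fun S h => by
      rcases min_choice 1 (c * p S) with h1 | h1
      · rw [hq, h1] at h; exact absurd h (lt_irrefl _)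
      · rw [hq, h1]; exact mul_le_mul_of_nonneg_right hmc (hp.1 S).le
    have hne : Nonempty (Coalition d) := by
      by_contra h
      rw [not_nonempty_iff] at h
      simpa using hp.2
    have hm0 : 0 < m := by
      rw [← hqm]; exact Finset.sum_pos (fun S _ => hq0 S) Finset.univ_nonempty
    have hw : ∀ S k, μ.real {ω | Y S ω = k} = coinWeight (q S) k := by
      intro S k
      rcases k with _ | _
      · have h1 := measureReal_compl (μ := μ) (hY.1 S (measurableSet_singleton true))
        have h2 : {ω | Y S ω = false} = (Y S ⁻¹' {true})ᶜ := by ext; simp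
        have h3 : μ.real (Y S ⁻¹' {true}) = q S := hY.2.2 S
        rw [h2, h1, h3, probReal_univ]; rfl
      · exact hY.2.2 S
    constructor
    · intro hm
      have h1 := hγ0 (projCompl Q *ᵥ vecBLam v lam)
      exact one_sub_lt_measureReal_regression hd hε hδ hδ1 hm0 hθ (by linarith) μ Y hY.1 hY.2.1
        (fun S => coinWeight (q S)) hw (bernoulliWeights q) (bernoulliGram Q q θ)
        (bernoulliGram_quadForm hq0 hθ0)
        (bernoulli_expTrace_le hd hQ hq0 hq1 hqp hp hθ0 (by rw [hθ]; linarith)) _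
        (bernoulli_second_moment hq0 hq1 hqp hp hm0 _)
        (fun f => RegressionAccurate Q v lam ε (sketchBernoulli q f)) fun f =>
          regressionAccurate_of_euclNorm_lt hd hQ v lam ε
            (sketchBernoulli_transpose_mul_self hq0 f)
    · intro hm
      exact one_sub_lt_measureReal_matVec hε hδ hm0 hm μ Y hY.1 hY.2.1
        (fun S => coinWeight (q S)) hw _ (bernoulli_second_moment hq0 hq1 hqp hp hm0 _)
        (fun f => MatVecAccurate Q v lam ε (sketchBernoulli q f)) fun f =>
          matVecAccurate_of_euclNorm_lt hd hQ v lam ε (sketchBernoulli_transpose_mul_self hq0 f)
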